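/- \textbf{Hypergraph Probing.} An instance consists of independent latent Bernoulli variables $Y_1,\dots,Y_m$ with known rational probabilities $\Pr(Y_j=1)=p_j\in[0,1]$, hyperedges $N(1),\dots,N(n)\subseteq\{1,\dots,m\}$, not all of them empty, and an integer $1\le k\le n$. The observed variables are $X_i=\bigvee_{j\in N(i)}Y_j$, and $\rho:=\max_i|N(i)|$ is the rank. Only the observed variables can be probed. An adaptive policy chooses the next variable to probe, among those not yet probed, depending on the outcomes seen so far; probing ends as soon as $k$ active variables ($X_i=1$) have been probed or all $n$ variables have been probed. The cost of a policy is its expected number of probes, and $\mathrm{opt}$ denotes the minimum cost of an adaptive policy. \textbf{Theorem.} There are a deterministic algorithm, a polynomial $q$ and an absolute constant $C>0$ such that the following holds for every instance. Given the instance (with all numbers in binary) and the outcomes of the probes made so far, the algorithm computes the next variable to probe in time at most $q(\text{bit size of the instance})$, and the adaptive policy obtained in this way has cost at most $C\,\rho^2\,(1+\log k)\cdot\mathrm{opt}$. In particular, for $k\ge 2$, it is a polynomial-time adaptive $O(\rho^2\log k)$-approximation relative to the optimal adaptive policy. -/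

import Mathlib

/-! ### A model of computation with logarithmic cost

Data are binary trees whose leaves carry natural numbers in binary.  Programs are built from
primitive operations by composition, pairing, branching and unbounded loops.  Every primitive
operation costs one plus the bit size of the data it reads and of the data it writes, so that
running times are polynomially related to those of Turing machines. -/

/-- Binary trees with natural numbers at the leaves. -/
inductive Val : Type
  | num (n : ℕ) : Val
  | pair (a b : Val) : Val

namespace Val

/-- The bit size of a tree: the binary lengths of its numbers plus its number of nodes. -/
def size : Val → ℕ
  | num n => Nat.size n + 1
  | pair a b => a.size + b.size + 1

/-- Lists are coded by nested pairs that end in the number `0`. -/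
def ofList : List Val → Val
  | [] => num 0
  | v :: l => pair v (ofList l)

end Val

/-- The primitive operations. -/
inductive Op : Type
  | id : Op
  | const (v : Val) : Op
  | fst : Op
  | snd : Op
  | isPair : Op
  | add : Op
  | sub : Op
  | mul : Op
  | div : Op

/-- A binary operation on numbers, applied to a pair of numbers (and `0` on all other trees). -/
def Val.arith (f : ℕ → ℕ → ℕ) : Val → Val
  | .pair (.num a) (.num b) => .num (f a b)
  | _ => .num 0

/-- The effect of a primitive operation.  Subtraction is truncated at `0`, division rounds down
(and division by `0` gives `0`). -/
def Op.eval : Op → Val → Val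
  | .id, x => x
  | .const v, _ => v
  | .fst, .pair a _ => a
  | .fst, .num _ => .num 0
  | .snd, .pair _ b => b
  | .snd, .num _ => .num 0
  | .isPair, .pair _ _ => .num 1
  | .isPair, .num _ => .num 0
  | .add, x => x.arith (fun a b => a + b)
  | .sub, x => x.arith (fun a b => a - b)
  | .mul, x => x.arith (fun a b => a * b)
  | .div, x => x.arith (fun a b => a / b)

/-- Programs.  `comp p q` runs `p` and then `q` on its result; `pair p q` pairs the results of `p`
and `q` on the same input; `ite c p q` runs `p` if `c` returns a value other than `0`, and `q`
otherwise; `loop c p` repeats `p` as long as `c` returns a value other than `0`. -/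
inductive Prog : Type
  | op (o : Op) : Prog
  | comp (p q : Prog) : Prog
  | pair (p q : Prog) : Prog
  | ite (c p q : Prog) : Prog
  | loop (c p : Prog) : Prog

/-- `Runs p x y t`: on input `x` the program `p` halts with output `y` after time exactly `t`. -/
inductive Runs : Prog → Val → Val → ℕ → Prop
  | op (o : Op) (x : Val) : Runs (.op o) x (o.eval x) (x.size + (o.eval x).size + 1)
  | comp {p q : Prog} {x y z : Val} {s t : ℕ} :
      Runs p x y s → Runs q y z t → Runs (.comp p q) x z (s + t + 1)
  | pair {p q : Prog} {x y z : Val} {s t : ℕ} :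
      Runs p x y s → Runs q x z t → Runs (.pair p q) x (.pair y z) (s + t + 1)
  | ite_true {c p q : Prog} {x v y : Val} {s t : ℕ} :
      Runs c x v s → v ≠ .num 0 → Runs p x y t → Runs (.ite c p q) x y (s + t + 1)
  | ite_false {c p q : Prog} {x y : Val} {s t : ℕ} :
      Runs c x (.num 0) s → Runs q x y t → Runs (.ite c p q) x y (s + t + 1)
  | loop_stop {c p : Prog} {x : Val} {s : ℕ} :
      Runs c x (.num 0) s → Runs (.loop c p) x x (s + 1)
  | loop_step {c p : Prog} {x v y z : Val} {s t u : ℕ} :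
      Runs c x v s → v ≠ .num 0 → Runs p x y t → Runs (.loop c p) y z u →
        Runs (.loop c p) x z (s + t + u + 1)

/-- Output and running time of a program are determined by its input. -/
theorem Runs.deterministic {p : Prog} {x y : Val} {t : ℕ} (h : Runs p x y t) :
    ∀ {y' : Val} {t' : ℕ}, Runs p x y' t' → y = y' ∧ t = t' := by
  induction h with
  | op o x => intro y' t' h'; cases h'; exact ⟨rfl, rfl⟩
  | comp _ _ ih1 ih2 =>
    intro y' t' h'; cases h' with
    | comp a b => obtain ⟨rfl, rfl⟩ := ih1 a; obtain ⟨rfl, rfl⟩ := ih2 b; exact ⟨rfl, rfl⟩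
  | pair _ _ ih1 ih2 =>
    intro y' t' h'; cases h' with
    | pair a b => obtain ⟨rfl, rfl⟩ := ih1 a; obtain ⟨rfl, rfl⟩ := ih2 b; exact ⟨rfl, rfl⟩
  | ite_true _ hv _ ih1 ih2 =>
    intro y' t' h'; cases h' with
    | ite_true a _ b => obtain ⟨rfl, rfl⟩ := ih1 a; obtain ⟨rfl, rfl⟩ := ih2 b; exact ⟨rfl, rfl⟩
    | ite_false a _ => exact absurd (ih1 a).1 hv
  | ite_false _ _ ih1 ih2 =>
    intro y' t' h'; cases h' with
    | ite_true a hv _ => exact absurd (ih1 a).1.symm hv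
    | ite_false a b => obtain ⟨_, rfl⟩ := ih1 a; obtain ⟨rfl, rfl⟩ := ih2 b; exact ⟨rfl, rfl⟩
  | loop_stop _ ih1 =>
    intro y' t' h'; cases h' with
    | loop_stop a => obtain ⟨_, rfl⟩ := ih1 a; exact ⟨rfl, rfl⟩
    | loop_step a hv _ _ => exact absurd (ih1 a).1.symm hv
  | loop_step _ hv _ _ ih1 ih2 ih3 =>
    intro y' t' h'; cases h' with
    | loop_stop a => exact absurd (ih1 a).1 hv
    | loop_step a _ b c =>
      obtain ⟨rfl, rfl⟩ := ih1 a; obtain ⟨rfl, rfl⟩ := ih2 b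
      obtain ⟨rfl, rfl⟩ := ih3 c; exact ⟨rfl, rfl⟩

/-! ### Hypergraph Probing -/

/-- An instance of Hypergraph Probing: `m` latent variables with (rational) probabilities `p j` of
being active, `n` observed variables with hyperedges `N i`, and the required number `k` of active
observed variables. -/
structure HGP where
  m : ℕ
  n : ℕ
  k : ℕ
  p : Fin m → ℚ
  N : Fin n → Finset (Fin m)
  p_nonneg : ∀ j, 0 ≤ p j
  p_le_one : ∀ j, p j ≤ 1
  one_le_k : 1 ≤ k
  k_le_n : k ≤ n

namespace HGP

/-- The rank: the maximum size of a hyperedge. -/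
def rank (I : HGP) : ℕ := Finset.univ.sup fun i => (I.N i).card

/-- The observed variable `X i` is the OR of the latent variables in `N i`. -/
def X (I : HGP) (Y : Fin I.m → Bool) (i : Fin I.n) : Bool := decide (∃ j ∈ I.N i, Y j = true)

/-- The probability of the outcome `Y` of the independent latent Bernoulli variables. -/
noncomputable def prob (I : HGP) (Y : Fin I.m → Bool) : ℝ :=
  ∏ j, if Y j then (I.p j : ℝ) else 1 - (I.p j : ℝ)

/-- A history: the observed variables probed so far with their outcomes, the latest one first. -/
abbrev History (I : HGP) : Type := List (Fin I.n × Bool)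

/-- Probing ends when `k` active variables have been found or all variables have been probed. -/
def Done (I : HGP) (h : I.History) : Prop := I.k ≤ h.countP (fun a => a.2) ∨ I.n ≤ h.length

instance (I : HGP) (h : I.History) : Decidable (I.Done h) :=
  inferInstanceAs (Decidable (_ ∨ _))

/-- The histories after which a further probe is due: no variable occurs twice, and probing has
not ended. -/
def Live (I : HGP) (h : I.History) : Prop := (h.map Prod.fst).Nodup ∧ ¬ I.Done h

/-- An adaptive policy: the next variable to probe, as a function of the history.  It never probes
a variable again. -/
structure Policy (I : HGP) where
  next : I.History → Fin I.n
  fresh : ∀ h, I.Live h → next h ∉ h.map Prod.fst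

/-- The history after at most `s` further probes of the policy, when the observed variables have
the values `x`. -/
def run (I : HGP) (π : I.Policy) (x : Fin I.n → Bool) : ℕ → I.History → I.History
  | 0, h => h
  | s + 1, h => if I.Done h then h else I.run π x s ((π.next h, x (π.next h)) :: h)

/-- The number of probes of the policy when the latent variables have the values `Y` (probing
always ends after at most `n` probes). -/
def cost (I : HGP) (π : I.Policy) (Y : Fin I.m → Bool) : ℕ := (I.run π (I.X Y) I.n []).length

/-- The expected number of probes. -/
noncomputable def expCost (I : HGP) (π : I.Policy) : ℝ := ∑ Y, I.prob Y * (I.cost π Y : ℝ)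

/-- The code of an instance: `k`, the list of the probabilities (numerator and denominator), and
the list of the hyperedges (each as the increasing list of its elements). -/
def code (I : HGP) : Val :=
  .pair (.num I.k) (.pair
    (Val.ofList (List.ofFn fun j => .pair (.num (I.p j).num.toNat) (.num (I.p j).den)))
    (Val.ofList (List.ofFn fun i =>
      Val.ofList (((List.finRange I.m).filter (fun j => j ∈ I.N i)).map fun j => .num j.val))))

/-- The code of a history, with `1` for active and `0` for inactive. -/
def codeHistory (I : HGP) (h : I.History) : Val :=
  Val.ofList (h.map fun a => .pair (.num a.1.val) (.num a.2.toNat))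

/-- The program `P` implements the policy `π`, each decision taking time at most `T`: from the
instance and the history it computes the variable that is probed next. -/
def Implements (I : HGP) (P : Prog) (π : I.Policy) (T : ℕ) : Prop :=
  ∀ h : I.History, I.Live h →
    ∃ t ≤ T, Runs P (.pair I.code (I.codeHistory h)) (.num (π.next h).val) t

end HGP

/-!
The approximation algorithm pursues latent variables.  If a probed variable turns out active, then
each of the at most `ρ` latent variables `j` in its hyperedge is pursued: the remaining variables
above `j` are probed until one of them is inactive (so that `j` is known to be inactive) or all of
them have been probed.  When no pursuit is in progress, every latent variable of an unprobed
hyperedge either is known to be inactive or lies in no probed hyperedge at all, and is then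
independent of the history.  At such a *greedy step* the policy probes a variable above a latent
variable `j` that maximizes the expected progress `p j * min (need) (number of unprobed variables
above j)`.  No conditional probability given active variables ever has to be computed.

*Cost.*  If fewer than `k` variables are active, every policy probes all `n` variables.  Otherwise
there are `k` active probes, which every policy makes; every inactive probe of a pursuit settles a
latent variable in an active hyperedge, so there are at most `ρ * k` of them (`HGP.length_le`);
it remains to bound the number `L` of greedy steps.

*Greedy steps.*  Let `α` be about `2 * ρ * (1 + log k)`.  The greedy step with index `g` is charged
`g * progress / need`.  Along every outcome these charges sum up to at most `H_k * L`, because a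
fraction of the need is at most a difference of harmonic numbers, and summation by parts turns the
weights `g` into a count of the steps (`HGP.sum_charge_le`).  On the other hand, another policy that
finds `k` active variables within `T = g / α` probes meets at most `ρ * T` fresh latent variables,
and the active ones among them account for the whole need.  Whether that policy meets `j` does not
depend on `Y j`, so the expected progress of the greedy step is at least `need / (ρ * T)` times the
probability that the other policy succeeds (`HGP.need_mul_sum_le`), and the expected charge is at
least `α / ρ` times this probability (`HGP.sum_success_le`).  All but `α * cost` of the greedy steps
have an index for which the other policy has succeeded, so the expectations satisfy
`(α / ρ) * (L - α * OPT) ≤ H_k * L`, up to the outcomes with fewer than `k` active variables, whence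
`L = O(α * OPT)` (`HGP.expCost_le_of_isGreedy`).

*Running time.*  The functions computable in polynomial time (`PolyTime`) are closed under
composition, branching, arithmetic, and folds over lists with accumulated values of polynomial
size.  The choice of the next variable is written with such operations (`Input.choice`): scores of
latent variables are fractions, compared by cross-multiplication.
-/

/-! ### Runs of a policy -/

namespace HGP

variable {I : HGP}

/-- The history after at most `s` probes, when the latent variables have the values `Y`. -/
def hist (I : HGP) (π : I.Policy) (Y : Fin I.m → Bool) (s : ℕ) : I.History :=
  I.run π (I.X Y) s []

theorem run_of_done (π : I.Policy) (x : Fin I.n → Bool) (s : ℕ) {h : I.History} (hd : I.Done h) :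
    I.run π x s h = h := by
  cases s with
  | zero => rfl
  | succ s => simp [run, hd]

theorem run_succ (π : I.Policy) (x : Fin I.n → Bool) (s : ℕ) (h : I.History) :
    I.run π x (s + 1) h = if I.Done (I.run π x s h) then I.run π x s h else
      (π.next (I.run π x s h), x (π.next (I.run π x s h))) :: I.run π x s h := by
  induction s generalizing h with
  | zero => rfl
  | succ s ih =>
    by_cases hd : I.Done h
    · simp [run_of_done, hd]
    · rw [run, if_neg hd, ih]
      simp [run, hd]

theorem hist_zero (π : I.Policy) (Y : Fin I.m → Bool) : I.hist π Y 0 = [] := rfl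

theorem hist_succ (π : I.Policy) (Y : Fin I.m → Bool) (s : ℕ) :
    I.hist π Y (s + 1) = if I.Done (I.hist π Y s) then I.hist π Y s else
      (π.next (I.hist π Y s), I.X Y (π.next (I.hist π Y s))) :: I.hist π Y s :=
  run_succ π _ s []

theorem hist_succ_of_done {π : I.Policy} {Y : Fin I.m → Bool} {s : ℕ}
    (hd : I.Done (I.hist π Y s)) : I.hist π Y (s + 1) = I.hist π Y s := by
  rw [hist_succ, if_pos hd]

theorem hist_succ_of_not_done {π : I.Policy} {Y : Fin I.m → Bool} {s : ℕ}
    (hd : ¬ I.Done (I.hist π Y s)) : I.hist π Y (s + 1) =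
      (π.next (I.hist π Y s), I.X Y (π.next (I.hist π Y s))) :: I.hist π Y s := by
  rw [hist_succ, if_neg hd]

theorem hist_of_done {π : I.Policy} {Y : Fin I.m → Bool} {s t : ℕ}
    (hd : I.Done (I.hist π Y s)) (hst : s ≤ t) : I.hist π Y t = I.hist π Y s := by
  induction t, hst using Nat.le_induction with
  | base => rfl
  | succ t _ ih => rw [hist_succ_of_done (by rwa [ih]), ih]

/-- A history that is free of repetitions and agrees with the values `x`. -/
structure Consistent (I : HGP) (x : Fin I.n → Bool) (h : I.History) : Prop where
  nodup : (h.map Prod.fst).Nodup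
  eq : ∀ a ∈ h, a.2 = x a.1

theorem hist_consistent (π : I.Policy) (Y : Fin I.m → Bool) (s : ℕ) :
    I.Consistent (I.X Y) (I.hist π Y s) := by
  induction s with
  | zero => exact ⟨by simp [hist_zero], by simp [hist_zero]⟩
  | succ s ih =>
    by_cases hd : I.Done (I.hist π Y s)
    · rwa [hist_succ_of_done hd]
    · rw [hist_succ_of_not_done hd]
      refine ⟨?_, ?_⟩
      · rw [List.map_cons, List.nodup_cons]
        exact ⟨π.fresh _ ⟨ih.nodup, hd⟩, ih.nodup⟩
      · intro a ha
        rcases List.mem_cons.1 ha with rfl | ha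
        · rfl
        · exact ih.eq a ha

theorem hist_live {π : I.Policy} {Y : Fin I.m → Bool} {s : ℕ}
    (hd : ¬ I.Done (I.hist π Y s)) : I.Live (I.hist π Y s) :=
  ⟨(hist_consistent π Y s).nodup, hd⟩

theorem hist_length_le (π : I.Policy) (Y : Fin I.m → Bool) (s : ℕ) :
    (I.hist π Y s).length ≤ s := by
  induction s with
  | zero => simp [hist_zero]
  | succ s ih =>
    by_cases hd : I.Done (I.hist π Y s)
    · rw [hist_succ_of_done hd]; omega
    · rw [hist_succ_of_not_done hd, List.length_cons]; omega

theorem hist_length_of_not_done {π : I.Policy} {Y : Fin I.m → Bool} {s : ℕ}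
    (hd : ¬ I.Done (I.hist π Y s)) : (I.hist π Y s).length = s := by
  induction s with
  | zero => simp [hist_zero]
  | succ s ih =>
    by_cases hd' : I.Done (I.hist π Y s)
    · exact absurd (by rwa [hist_succ_of_done hd']) hd
    · rw [hist_succ_of_not_done hd', List.length_cons, ih hd']

theorem hist_done (π : I.Policy) (Y : Fin I.m → Bool) : I.Done (I.hist π Y I.n) := by
  by_contra hd
  exact hd (Or.inr (hist_length_of_not_done hd).ge)

theorem hist_length_mono (π : I.Policy) (Y : Fin I.m → Bool) :
    Monotone fun s => (I.hist π Y s).length := by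
  refine monotone_nat_of_le_succ fun s => ?_
  rw [hist_succ]
  split_ifs
  · exact le_rfl
  · rw [List.length_cons]; omega

theorem hist_of_cost_le {π : I.Policy} {Y : Fin I.m → Bool} {T : ℕ}
    (hT : I.cost π Y ≤ T) : I.hist π Y T = I.hist π Y I.n := by
  have hd : I.Done (I.hist π Y T) := by
    by_contra hd
    have h1 : (I.hist π Y (T + 1)).length = T + 1 := by
      rw [hist_succ_of_not_done hd, List.length_cons, hist_length_of_not_done hd]
    have hTn : T + 1 ≤ I.n := by
      by_contra hlt
      exact hd (by rw [hist_of_done (hist_done π Y) (by omega)]; exact hist_done π Y)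
    have h2 : (I.hist π Y (T + 1)).length ≤ I.cost π Y := hist_length_mono π Y hTn
    omega
  rcases le_total T I.n with h | h
  · exact (hist_of_done hd h).symm
  · exact hist_of_done (hist_done π Y) h

/-- A run only depends on the values of the variables that it probes. -/
theorem hist_congr {π : I.Policy} {Y Y' : Fin I.m → Bool} {s : ℕ}
    (h : ∀ a ∈ I.hist π Y s, I.X Y' a.1 = I.X Y a.1) : I.hist π Y' s = I.hist π Y s := by
  induction s with
  | zero => rfl
  | succ s ih =>
    by_cases hd : I.Done (I.hist π Y s)
    · rw [hist_succ_of_done hd] at h ⊢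
      have := ih h
      rw [hist_succ_of_done (by rwa [this]), this]
    · rw [hist_succ_of_not_done hd] at h ⊢
      have := ih fun a ha => h a (List.mem_cons_of_mem _ ha)
      rw [hist_succ_of_not_done (by rwa [this]), this, h _ List.mem_cons_self]

theorem X_update {Y : Fin I.m → Bool} {j : Fin I.m} {i : Fin I.n} (hj : j ∉ I.N i) (b : Bool) :
    I.X (Function.update Y j b) i = I.X Y i := by
  unfold X
  congr 1
  apply propext
  refine exists_congr fun l => and_congr_right fun hl => ?_
  rw [Function.update_of_ne (by rintro rfl; exact hj hl)]

/-- Changing a latent variable that lies in no probed hyperedge does not change the run. -/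
theorem hist_update {π : I.Policy} {Y : Fin I.m → Bool} {s : ℕ} {j : Fin I.m}
    (h : ∀ a ∈ I.hist π Y s, j ∉ I.N a.1) (b : Bool) :
    I.hist π (Function.update Y j b) s = I.hist π Y s :=
  hist_congr fun a ha => X_update (h a ha) b

/-! ### Counting active variables -/

/-- The observed variables that a history reports active. -/
def activeSet (I : HGP) (h : I.History) : Finset (Fin I.n) :=
  Finset.univ.filter fun i => (i, true) ∈ h

/-- All active observed variables. -/
def actives (I : HGP) (Y : Fin I.m → Bool) : Finset (Fin I.n) :=
  Finset.univ.filter fun i => I.X Y i = true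

theorem card_activeSet {h : I.History} (hn : (h.map Prod.fst).Nodup) :
    (I.activeSet h).card = h.countP (fun a => a.2) := by
  induction h with
  | nil => simp [activeSet]
  | cons a h ih =>
    rw [List.map_cons, List.nodup_cons] at hn
    have ih := ih hn.2
    obtain ⟨i, b⟩ := a
    have hi : (i, true) ∉ h := fun hmem => hn.1 (List.mem_map.2 ⟨_, hmem, rfl⟩)
    cases b with
    | false =>
      have : I.activeSet ((i, false) :: h) = I.activeSet h := by
        ext l; simp [activeSet]
      rw [this, ih]; simp
    | true =>
      have : I.activeSet ((i, true) :: h) = insert i (I.activeSet h) := by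
        ext l; simp [activeSet]
      rw [this, Finset.card_insert_of_notMem (by simpa [activeSet] using hi), ih]; simp

theorem Consistent.mem_activeSet {Y : Fin I.m → Bool} {h : I.History}
    (hc : I.Consistent (I.X Y) h) {i : Fin I.n} :
    i ∈ I.activeSet h ↔ i ∈ I.actives Y ∧ i ∈ h.map Prod.fst := by
  simp only [activeSet, actives, Finset.mem_filter, Finset.mem_univ, true_and, List.mem_map]
  constructor
  · intro hi; exact ⟨(hc.eq _ hi).symm, _, hi, rfl⟩
  · rintro ⟨hx, ⟨i', b⟩, ha, rfl⟩
    have := hc.eq _ ha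
    simp only at this hx
    rwa [this, hx] at ha

theorem Consistent.countP_le {Y : Fin I.m → Bool} {h : I.History}
    (hc : I.Consistent (I.X Y) h) : h.countP (fun a => a.2) ≤ (I.actives Y).card := by
  rw [← card_activeSet hc.nodup]
  exact Finset.card_le_card fun i hi => (hc.mem_activeSet.1 hi).1

theorem hist_countP_le (π : I.Policy) (Y : Fin I.m → Bool) (s : ℕ) :
    (I.hist π Y s).countP (fun a => a.2) ≤ I.k := by
  induction s with
  | zero => simp [hist_zero]
  | succ s ih =>
    by_cases hd : I.Done (I.hist π Y s)
    · rwa [hist_succ_of_done hd]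
    · rw [hist_succ_of_not_done hd, List.countP_cons]
      have : ¬ I.k ≤ (I.hist π Y s).countP (fun a => a.2) := fun h => hd (Or.inl h)
      split_ifs <;> omega

theorem cost_eq_of_card_actives_lt (π : I.Policy) {Y : Fin I.m → Bool}
    (h : (I.actives Y).card < I.k) : I.cost π Y = I.n := by
  refine le_antisymm (hist_length_le π Y I.n) ?_
  rcases hist_done π Y with hd | hd
  · have := (hist_consistent π Y I.n).countP_le
    omega
  · exact hd

theorem le_countP_hist (π : I.Policy) {Y : Fin I.m → Bool} (h : I.k ≤ (I.actives Y).card) :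
    I.k ≤ (I.hist π Y I.n).countP (fun a => a.2) := by
  rcases hist_done π Y with hd | hd
  · exact hd
  · have hc := hist_consistent π Y I.n
    have hall : ∀ i, i ∈ (I.hist π Y I.n).map Prod.fst := by
      intro i
      have h1 : ((I.hist π Y I.n).map Prod.fst).toFinset = Finset.univ := by
        apply Finset.eq_univ_of_card
        rw [List.toFinset_card_of_nodup hc.nodup, List.length_map, Fintype.card_fin]
        exact le_antisymm (hist_length_le π Y I.n) hd
      rw [← List.mem_toFinset, h1]; exact Finset.mem_univ i
    rw [← card_activeSet hc.nodup]
    refine h.trans (Finset.card_le_card fun i hi => hc.mem_activeSet.2 ⟨hi, hall i⟩)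

theorem k_le_cost (π : I.Policy) {Y : Fin I.m → Bool} (h : I.k ≤ (I.actives Y).card) :
    I.k ≤ I.cost π Y :=
  (le_countP_hist π h).trans List.countP_le_length

/-! ### The latent variables as independent random bits -/

theorem prob_nonneg (I : HGP) (Y : Fin I.m → Bool) : 0 ≤ I.prob Y := by
  refine Finset.prod_nonneg fun j _ => ?_
  have h0 : (0 : ℝ) ≤ I.p j := by exact_mod_cast I.p_nonneg j
  have h1 : (I.p j : ℝ) ≤ 1 := by exact_mod_cast I.p_le_one j
  split_ifs <;> linarith

theorem prob_update (I : HGP) (Y : Fin I.m → Bool) (j : Fin I.m) (b : Bool) :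
    I.prob (Function.update Y j b) = (if b then (I.p j : ℝ) else 1 - I.p j) *
      ∏ l ∈ Finset.univ.erase j, if Y l then (I.p l : ℝ) else 1 - (I.p l : ℝ) := by
  unfold prob
  rw [← Finset.mul_prod_erase _ _ (Finset.mem_univ j)]
  congr 1
  · simp
  · refine Finset.prod_congr rfl fun l hl => ?_
    rw [Function.update_of_ne (Finset.ne_of_mem_erase hl)]

/-- A latent variable is independent of every quantity that does not change with it. -/
theorem sum_prob_mul_of_invariant (I : HGP) (j : Fin I.m) (A : (Fin I.m → Bool) → ℝ)
    (hA : ∀ Y b, A (Function.update Y j b) = A Y) :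
    ∑ Y, I.prob Y * (A Y * if Y j then 1 else 0) = I.p j * ∑ Y, I.prob Y * A Y := by
  rw [Finset.mul_sum, ← sub_eq_zero, ← Finset.sum_sub_distrib]
  refine Finset.sum_involution (fun Y _ => Function.update Y j (!Y j)) ?_ ?_ ?_ ?_
  · intro Y _
    have h1 := prob_update I Y j (!Y j)
    have h2 := prob_update I Y j (Y j)
    rw [Function.update_eq_self] at h2
    simp only [hA, h1, Function.update_self]
    rw [h2]
    cases Y j <;> simp <;> ring
  · intro Y _ _ h
    have := congrFun h j
    simp at this
  · intro Y _; exact Finset.mem_univ _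
  · intro Y _; simp

end HGP

/-! ### Greedy policies -/

namespace HGP

variable {I : HGP}

/-- The latent variables that the history shows to be inactive. -/
def dead (I : HGP) (h : I.History) : Finset (Fin I.m) :=
  Finset.univ.filter fun j => ∃ i, (i, false) ∈ h ∧ j ∈ I.N i

/-- The latent variables in hyperedges that the history reports active. -/
def touched (I : HGP) (h : I.History) : Finset (Fin I.m) :=
  Finset.univ.filter fun j => ∃ i, (i, true) ∈ h ∧ j ∈ I.N i

/-- The observed variables above `j` that have not been probed. -/
def above (I : HGP) (h : I.History) (j : Fin I.m) : Finset (Fin I.n) :=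
  Finset.univ.filter fun i => i ∉ h.map Prod.fst ∧ j ∈ I.N i

/-- The number of active variables still to be found. -/
def need (I : HGP) (h : I.History) : ℕ := I.k - h.countP (fun a => a.2)

/-- The progress made if `j` is active and all variables above `j` get probed. -/
def weight (I : HGP) (h : I.History) (j : Fin I.m) : ℕ := min (I.need h) (I.above h j).card

/-- Some latent variable in an active hyperedge is not known to be inactive and has a variable
above it that is still to be probed. -/
def Closing (I : HGP) (h : I.History) : Prop :=
  ∃ i ∉ h.map Prod.fst, ∃ j ∈ I.N i, j ∈ I.touched h ∧ j ∉ I.dead h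

open Classical in
/-- The number of probes of a history that were made when no latent variable was being pursued. -/
noncomputable def greedySteps (I : HGP) : I.History → ℕ
  | [] => 0
  | _ :: h => greedySteps I h + if I.Closing h then 0 else 1

/-- A policy is greedy if it first pursues the latent variables in active hyperedges, and otherwise
maximizes the expected progress `p j * weight h j`. -/
structure IsGreedy (I : HGP) (π : I.Policy) : Prop where
  pursue : ∀ h, I.Live h → I.Closing h → ∃ j ∈ I.N (π.next h), j ∈ I.touched h ∧ j ∉ I.dead h
  best : ∀ h, I.Live h → ¬ I.Closing h → ∀ i ∉ h.map Prod.fst, ∀ j ∈ I.N i, j ∉ I.dead h →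
    I.p j * I.weight h j = 0 ∨
      ∃ l ∈ I.N (π.next h), l ∉ I.dead h ∧ I.p j * I.weight h j ≤ I.p l * I.weight h l

theorem mem_dead {h : I.History} {j : Fin I.m} :
    j ∈ I.dead h ↔ ∃ i, (i, false) ∈ h ∧ j ∈ I.N i := by simp [dead]

theorem mem_touched {h : I.History} {j : Fin I.m} :
    j ∈ I.touched h ↔ ∃ i, (i, true) ∈ h ∧ j ∈ I.N i := by simp [touched]

theorem mem_above {h : I.History} {j : Fin I.m} {i : Fin I.n} :
    i ∈ I.above h j ↔ i ∉ h.map Prod.fst ∧ j ∈ I.N i := by simp [above]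

theorem dead_mono (a : Fin I.n × Bool) (h : I.History) : I.dead h ⊆ I.dead (a :: h) := by
  intro j hj
  obtain ⟨i, hi, hj⟩ := mem_dead.1 hj
  exact mem_dead.2 ⟨i, List.mem_cons_of_mem _ hi, hj⟩

theorem touched_mono (a : Fin I.n × Bool) (h : I.History) :
    I.touched h ⊆ I.touched (a :: h) := by
  intro j hj
  obtain ⟨i, hi, hj⟩ := mem_touched.1 hj
  exact mem_touched.2 ⟨i, List.mem_cons_of_mem _ hi, hj⟩

theorem X_eq_true {Y : Fin I.m → Bool} {i : Fin I.n} :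
    I.X Y i = true ↔ ∃ j ∈ I.N i, Y j = true := by simp [X]

theorem Consistent.notMem_dead {Y : Fin I.m → Bool} {h : I.History}
    (hc : I.Consistent (I.X Y) h) {j : Fin I.m} (hj : Y j = true) : j ∉ I.dead h := by
  intro hd
  obtain ⟨i, hi, hji⟩ := mem_dead.1 hd
  have h1 := hc.eq _ hi
  have h2 := X_eq_true.2 ⟨j, hji, hj⟩
  simp only at h1
  rw [h2] at h1
  exact absurd h1 (by decide)

theorem need_pos {h : I.History} (hd : ¬ I.Done h) : 0 < I.need h := by
  have : ¬ I.k ≤ h.countP (fun a => a.2) := fun h' => hd (Or.inl h')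
  unfold need; omega

theorem card_touched_le {h : I.History} (hn : (h.map Prod.fst).Nodup) :
    (I.touched h).card ≤ h.countP (fun a => a.2) * I.rank := by
  rw [← card_activeSet hn]
  have : I.touched h = (I.activeSet h).biUnion I.N := by
    ext j; simp [touched, activeSet]
  rw [this]
  exact Finset.card_biUnion_le_card_mul _ _ _ fun i _ => Finset.le_sup (f := fun i =>
    (I.N i).card) (Finset.mem_univ i)

theorem greedySteps_le_length (h : I.History) : I.greedySteps h ≤ h.length := by
  induction h with
  | nil => simp [greedySteps]
  | cons a h ih =>
    rw [greedySteps, List.length_cons]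
    split_ifs <;> omega

/-- An inactive probe made in pursuit of a latent variable shows that this variable of an active
hyperedge is inactive, so there are at most `rank` such probes for every active variable. -/
theorem length_le (π : I.Policy) (hπ : I.IsGreedy π) (Y : Fin I.m → Bool) (s : ℕ) :
    (I.hist π Y s).length ≤ (I.hist π Y s).countP (fun a => a.2) + I.greedySteps (I.hist π Y s) +
      (I.touched (I.hist π Y s) ∩ I.dead (I.hist π Y s)).card := by
  induction s with
  | zero => simp [hist_zero]
  | succ s ih =>
    by_cases hd : I.Done (I.hist π Y s)
    · rwa [hist_succ_of_done hd]
    · rw [hist_succ_of_not_done hd]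
      have hl := hist_live hd
      set h := I.hist π Y s
      have hmono : (I.touched h ∩ I.dead h).card ≤
          (I.touched ((π.next h, I.X Y (π.next h)) :: h) ∩
            I.dead ((π.next h, I.X Y (π.next h)) :: h)).card :=
        Finset.card_le_card (Finset.inter_subset_inter (touched_mono _ _) (dead_mono _ _))
      rw [List.length_cons, List.countP_cons, greedySteps]
      cases hx : I.X Y (π.next h) with
      | true => rw [hx] at hmono; simp only [if_true]; omega
      | false =>
        rw [hx] at hmono
        by_cases hcl : I.Closing h
        · obtain ⟨j, hj, hjt, hjd⟩ := hπ.pursue h hl hcl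
          have : (I.touched h ∩ I.dead h).card < (I.touched ((π.next h, false) :: h) ∩
              I.dead ((π.next h, false) :: h)).card := by
            refine Finset.card_lt_card (Finset.ssubset_iff_subset_ne.2
              ⟨Finset.inter_subset_inter (touched_mono _ _) (dead_mono _ _), fun heq => hjd ?_⟩)
            have : j ∈ I.touched ((π.next h, false) :: h) ∩ I.dead ((π.next h, false) :: h) :=
              Finset.mem_inter.2 ⟨touched_mono _ _ hjt,
                mem_dead.2 ⟨_, List.mem_cons_self, hj⟩⟩
            rw [← heq] at this
            exact (Finset.mem_inter.1 this).2
          simp only [if_pos hcl]; omega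
        · simp only [if_neg hcl]; omega

theorem cost_le_add_greedySteps (π : I.Policy) (hπ : I.IsGreedy π) (Y : Fin I.m → Bool) :
    I.cost π Y ≤ I.k + I.greedySteps (I.hist π Y I.n) + I.k * I.rank := by
  have h1 := length_le π hπ Y I.n
  have h2 := hist_countP_le π Y I.n
  have h3 := card_touched_le (hist_consistent π Y I.n).nodup
  have h4 : (I.touched (I.hist π Y I.n) ∩ I.dead (I.hist π Y I.n)).card ≤
    (I.touched (I.hist π Y I.n)).card := Finset.card_le_card Finset.inter_subset_left
  have h5 := Nat.mul_le_mul_right I.rank h2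
  have : I.cost π Y = (I.hist π Y I.n).length := rfl
  omega

/-! ### Progress of a greedy policy along one outcome -/

/-- The active variables that have been probed or lie above an active latent variable that is
being pursued. -/
def covered (I : HGP) (Y : Fin I.m → Bool) (h : I.History) : Finset (Fin I.n) :=
  Finset.univ.filter fun i => I.X Y i = true ∧
    (i ∈ h.map Prod.fst ∨ ∃ j ∈ I.N i, Y j = true ∧ j ∈ I.touched h)

theorem covered_mono (Y : Fin I.m → Bool) (a : Fin I.n × Bool) (h : I.History) :
    I.covered Y h ⊆ I.covered Y (a :: h) := by
  intro i hi
  simp only [covered, Finset.mem_filter, Finset.mem_univ, true_and] at hi ⊢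
  refine ⟨hi.1, hi.2.imp (fun h' => ?_) ?_⟩
  · rw [List.map_cons]; exact List.mem_cons_of_mem _ h'
  · rintro ⟨j, hj, hY, ht⟩; exact ⟨j, hj, hY, touched_mono _ _ ht⟩

theorem covered_of_not_closing {Y : Fin I.m → Bool} {h : I.History}
    (hc : I.Consistent (I.X Y) h) (hcl : ¬ I.Closing h) : I.covered Y h = I.activeSet h := by
  ext i
  rw [hc.mem_activeSet]
  simp only [covered, actives, Finset.mem_filter, Finset.mem_univ, true_and]
  refine and_congr_right fun hx => ⟨?_, Or.inl⟩
  rintro (hi | ⟨j, hj, hY, ht⟩)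
  · exact hi
  · by_contra hi
    exact hcl ⟨i, hi, j, hj, ht, hc.notMem_dead hY⟩

/-- The progress that a probe of `i` leads to: the largest weight of an active latent variable in
the hyperedge `i`. -/
def progress (I : HGP) (h : I.History) (i : Fin I.n) (Y : Fin I.m → Bool) : ℕ :=
  (I.N i).sup fun j => if Y j then I.weight h j else 0

theorem progress_le_need (h : I.History) (i : Fin I.n) (Y : Fin I.m → Bool) :
    I.progress h i Y ≤ I.need h := by
  refine Finset.sup_le fun j _ => ?_
  split_ifs
  · exact min_le_left _ _
  · exact Nat.zero_le _

theorem need_sub_progress {Y : Fin I.m → Bool} {h : I.History} {i : Fin I.n}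
    (hc : I.Consistent (I.X Y) h) :
    I.k - (I.covered Y ((i, I.X Y i) :: h)).card ≤ I.need h - I.progress h i Y := by
  have hact : I.activeSet h ⊆ I.covered Y h := by
    intro l hl
    have := hc.mem_activeSet.1 hl
    simp only [covered, actives, Finset.mem_filter, Finset.mem_univ, true_and] at this ⊢
    exact ⟨this.1, Or.inl this.2⟩
  have h0 := Finset.card_le_card (hact.trans (covered_mono Y (i, I.X Y i) h))
  rw [card_activeSet hc.nodup] at h0
  have key : I.progress h i Y = 0 ∨ ∃ j ∈ I.N i, Y j = true ∧ I.progress h i Y = I.weight h j := by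
    by_cases hne : (I.N i).Nonempty
    · obtain ⟨j, hj, he⟩ := Finset.exists_mem_eq_sup (I.N i) hne
        fun j => if Y j then I.weight h j else 0
      by_cases hY : Y j = true
      · right; refine ⟨j, hj, hY, ?_⟩; rw [progress, he]; simp [hY]
      · left; rw [progress, he]; simp [hY]
    · left; rw [Finset.not_nonempty_iff_eq_empty] at hne; simp [progress, hne]
  rcases key with h1 | ⟨j, hj, hY, h1⟩
  · rw [h1]; unfold need; omega
  · have hx : I.X Y i = true := X_eq_true.2 ⟨j, hj, hY⟩
    have hsub : I.activeSet h ∪ I.above h j ⊆ I.covered Y ((i, I.X Y i) :: h) := by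
      refine Finset.union_subset (hact.trans (covered_mono Y _ h)) fun l hl => ?_
      obtain ⟨_, hjl⟩ := mem_above.1 hl
      simp only [covered, Finset.mem_filter, Finset.mem_univ, true_and]
      refine ⟨X_eq_true.2 ⟨j, hjl, hY⟩, Or.inr ⟨j, hjl, hY, mem_touched.2 ⟨i, ?_, hj⟩⟩⟩
      rw [hx]; exact List.mem_cons_self
    have hdisj : Disjoint (I.activeSet h) (I.above h j) := by
      rw [Finset.disjoint_left]
      intro l hl hl'
      exact (mem_above.1 hl').1 (hc.mem_activeSet.1 hl).2
    have h2 := Finset.card_le_card hsub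
    rw [Finset.card_union_of_disjoint hdisj, card_activeSet hc.nodup] at h2
    rw [h1]; unfold weight need
    omega

/-- The harmonic numbers as real numbers. -/
noncomputable def harm (r : ℕ) : ℝ := ∑ i ∈ Finset.range r, ((i : ℝ) + 1)⁻¹

theorem harm_mono : Monotone harm := by
  refine monotone_nat_of_le_succ fun r => ?_
  rw [harm, harm, Finset.sum_range_succ]
  have : (0 : ℝ) ≤ ((r : ℝ) + 1)⁻¹ := by positivity
  linarith

theorem harm_le (r : ℕ) : harm r ≤ 1 + Real.log r := by
  have := harmonic_le_one_add_log r
  refine le_trans (le_of_eq ?_) this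
  simp [harm, harmonic]

theorem div_le_harm_sub (r c : ℕ) (hc : c ≤ r) : (c : ℝ) / r ≤ harm r - harm (r - c) := by
  induction c with
  | zero => simp
  | succ c ih =>
    have ih := ih (by omega)
    have h1 : r - c = (r - (c + 1)) + 1 := by omega
    have h2 : harm (r - c) = harm (r - (c + 1)) + (((r - (c + 1) : ℕ) : ℝ) + 1)⁻¹ := by
      rw [h1, harm, Finset.sum_range_succ, harm]
    have h3 : (r : ℝ)⁻¹ ≤ (((r - (c + 1) : ℕ) : ℝ) + 1)⁻¹ := by
      apply inv_anti₀ (by positivity)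
      have : r - (c + 1) + 1 ≤ r := by omega
      exact_mod_cast this
    have h4 : ((c + 1 : ℕ) : ℝ) / r = (c : ℝ) / r + (r : ℝ)⁻¹ := by
      push_cast; ring
    linarith

open Classical in
/-- A greedy step is charged the fraction of the need that it leads to, multiplied by its index
among the greedy steps. -/
noncomputable def charge (I : HGP) (π : I.Policy) (h : I.History) (Y : Fin I.m → Bool) : ℝ :=
  if I.Done h ∨ I.Closing h then 0 else
    ((I.greedySteps h : ℝ) + 1) * (I.progress h (π.next h) Y / I.need h)

theorem sum_charge_add_le (π : I.Policy) (Y : Fin I.m → Bool) (t : ℕ) :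
    ∑ s ∈ Finset.range t, I.charge π (I.hist π Y s) Y +
      I.greedySteps (I.hist π Y t) * harm (I.k - (I.covered Y (I.hist π Y t)).card) ≤
      harm I.k * I.greedySteps (I.hist π Y t) := by
  induction t with
  | zero => simp [hist_zero, greedySteps]
  | succ t ih =>
    rw [Finset.sum_range_succ]
    by_cases hd : I.Done (I.hist π Y t)
    · rw [hist_succ_of_done hd, charge, if_pos (Or.inl hd)]
      linarith
    · rw [hist_succ_of_not_done hd]
      have hc := hist_consistent π Y t
      set h := I.hist π Y t
      have hg0 : (0 : ℝ) ≤ I.greedySteps h := Nat.cast_nonneg _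
      by_cases hcl : I.Closing h
      · have hm := harm_mono (Nat.sub_le_sub_left (Finset.card_le_card
          (covered_mono Y (π.next h, I.X Y (π.next h)) h)) I.k)
        rw [charge, if_pos (Or.inr hcl), greedySteps, if_pos hcl]
        simp only [add_zero]
        have := mul_le_mul_of_nonneg_left hm hg0
        linarith
      · have hcov : I.k - (I.covered Y h).card = I.need h := by
          rw [covered_of_not_closing hc hcl, card_activeSet hc.nodup]; rfl
        have hm := harm_mono (need_sub_progress (i := π.next h) hc)
        have hdiv := div_le_harm_sub (I.need h) _ (progress_le_need h (π.next h) Y)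
        have hk : harm (I.need h) ≤ harm I.k := harm_mono (Nat.sub_le _ _)
        rw [charge, if_neg (by tauto), greedySteps, if_neg hcl]
        rw [hcov] at ih
        push_cast
        have := mul_le_mul_of_nonneg_left (hm.trans (le_sub_comm.1 hdiv))
          (by linarith : (0 : ℝ) ≤ (I.greedySteps h : ℝ) + 1)
        linarith

theorem harm_nonneg (r : ℕ) : 0 ≤ harm r :=
  Finset.sum_nonneg fun _ _ => by positivity

/-- The charges of all greedy steps sum up to at most a harmonic number times the number of greedy
steps. -/
theorem sum_charge_le (π : I.Policy) (Y : Fin I.m → Bool) (t : ℕ) :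
    ∑ s ∈ Finset.range t, I.charge π (I.hist π Y s) Y ≤
      harm I.k * I.greedySteps (I.hist π Y t) := by
  have := sum_charge_add_le π Y t
  have h2 : 0 ≤ (I.greedySteps (I.hist π Y t) : ℝ) *
    harm (I.k - (I.covered Y (I.hist π Y t)).card) := mul_nonneg (Nat.cast_nonneg _) (harm_nonneg _)
  linarith

open Classical in
/-- All but `c` of the greedy steps have index at least `c`. -/
theorem greedySteps_le (π : I.Policy) (Y : Fin I.m → Bool) (c t : ℕ) :
    I.greedySteps (I.hist π Y t) ≤ ∑ s ∈ Finset.range t,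
      (if I.Done (I.hist π Y s) ∨ I.Closing (I.hist π Y s) then 0 else
        if c ≤ I.greedySteps (I.hist π Y s) + 1 then 1 else 0) + c := by
  induction t with
  | zero => simp [hist_zero, greedySteps]
  | succ t ih =>
    rw [Finset.sum_range_succ]
    by_cases hd : I.Done (I.hist π Y t)
    · rw [hist_succ_of_done hd]; omega
    · rw [hist_succ_of_not_done hd, greedySteps]
      by_cases hcl : I.Closing (I.hist π Y t)
      · rw [if_pos hcl]; omega
      · rw [if_neg hcl, if_neg (by tauto)]
        split_ifs <;> omega

end HGP

/-! ### Comparison with an arbitrary policy -/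

namespace HGP

variable {I : HGP}

/-- The latent variables that are not known to be inactive and lie in hyperedges that have not been
probed. -/
def fresh (I : HGP) (h : I.History) : Finset (Fin I.m) :=
  Finset.univ.filter fun j => (∃ i ∉ h.map Prod.fst, j ∈ I.N i) ∧ j ∉ I.dead h

theorem mem_fresh {h : I.History} {j : Fin I.m} :
    j ∈ I.fresh h ↔ (∃ i ∉ h.map Prod.fst, j ∈ I.N i) ∧ j ∉ I.dead h := by simp [fresh]

theorem notMem_of_mem_fresh {h : I.History} (hcl : ¬ I.Closing h) {j : Fin I.m}
    (hj : j ∈ I.fresh h) : ∀ a ∈ h, j ∉ I.N a.1 := by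
  rintro ⟨i, b⟩ ha hji
  obtain ⟨⟨i', hi', hj'⟩, hd⟩ := mem_fresh.1 hj
  cases b with
  | false => exact hd (mem_dead.2 ⟨i, ha, hji⟩)
  | true => exact hcl ⟨i', hi', j, hj', mem_touched.2 ⟨i, ha, hji⟩, hd⟩

theorem update_update_self (Y : Fin I.m → Bool) (j : Fin I.m) (b : Bool) :
    Function.update (Function.update Y j b) j (Y j) = Y := by simp

/-- Changing a fresh latent variable does not change whether a history with no pursuit in progress
is reached. -/
theorem hist_update_eq_iff {π : I.Policy} {h : I.History} (hcl : ¬ I.Closing h) {j : Fin I.m}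
    (hj : j ∈ I.fresh h) (t : ℕ) (Y : Fin I.m → Bool) (b : Bool) :
    I.hist π (Function.update Y j b) t = h ↔ I.hist π Y t = h := by
  have key : ∀ (Y : Fin I.m → Bool) b, I.hist π Y t = h →
      I.hist π (Function.update Y j b) t = h := by
    intro Y b hY
    rw [hist_update _ b, hY]
    rw [hY]; exact notMem_of_mem_fresh hcl hj
  refine ⟨fun h' => ?_, key Y b⟩
  have := key _ (Y j) h'
  rwa [update_update_self] at this

/-- Whether a policy probes a variable above `j` does not depend on the value of `j`. -/
theorem exists_mem_hist_update_iff {π : I.Policy} (T : ℕ) (Y : Fin I.m → Bool) (j : Fin I.m)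
    (b : Bool) : (∃ a ∈ I.hist π (Function.update Y j b) T, j ∈ I.N a.1) ↔
      ∃ a ∈ I.hist π Y T, j ∈ I.N a.1 := by
  have key : ∀ (Y : Fin I.m → Bool) b, (∃ a ∈ I.hist π (Function.update Y j b) T, j ∈ I.N a.1) →
      ∃ a ∈ I.hist π Y T, j ∈ I.N a.1 := by
    intro Y b h
    by_contra hno
    rw [hist_update fun a ha hj => hno ⟨a, ha, hj⟩] at h
    exact hno h
  refine ⟨key Y b, fun h => key _ (Y j) ?_⟩
  rwa [update_update_self]

/-- If another policy finds `k` active variables, then the fresh active latent variables that it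
comes across suffice for the remaining need. -/
theorem need_le_sum_weight {Y : Fin I.m → Bool} {h h' : I.History} (hc : I.Consistent (I.X Y) h)
    (hc' : I.Consistent (I.X Y) h') (hk : I.k ≤ h'.countP (fun a => a.2)) :
    I.need h ≤ ∑ j ∈ I.fresh h,
      if (∃ a ∈ h', j ∈ I.N a.1) ∧ Y j = true then I.weight h j else 0 := by
  set S := (I.fresh h).filter fun j => (∃ a ∈ h', j ∈ I.N a.1) ∧ Y j = true with hS
  rw [← Finset.sum_filter]
  have hsub : I.activeSet h' \ I.activeSet h ⊆ S.biUnion (I.above h) := by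
    intro i hi
    obtain ⟨hi', hi⟩ := Finset.mem_sdiff.1 hi
    obtain ⟨hx, hm⟩ := hc'.mem_activeSet.1 hi'
    have hnm : i ∉ h.map Prod.fst := fun hm' => hi (hc.mem_activeSet.2 ⟨hx, hm'⟩)
    obtain ⟨j, hj, hY⟩ := X_eq_true.1 (Finset.mem_filter.1 hx).2
    obtain ⟨a, ha, rfl⟩ := List.mem_map.1 hm
    refine Finset.mem_biUnion.2 ⟨j, Finset.mem_filter.2
      ⟨mem_fresh.2 ⟨⟨_, hnm, hj⟩, hc.notMem_dead hY⟩, ⟨a, ha, hj⟩, hY⟩, mem_above.2 ⟨hnm, hj⟩⟩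
  have h1 : I.need h ≤ ∑ j ∈ S, (I.above h j).card := by
    have h2 := (Finset.card_le_card hsub).trans Finset.card_biUnion_le
    have h3 := Finset.le_card_sdiff (I.activeSet h) (I.activeSet h')
    rw [card_activeSet hc.nodup, card_activeSet hc'.nodup] at h3
    unfold need; omega
  by_cases hbig : ∃ j ∈ S, I.need h ≤ (I.above h j).card
  · obtain ⟨j, hj, hle⟩ := hbig
    refine le_trans ?_ (Finset.single_le_sum (f := fun j => I.weight h j)
      (fun _ _ => Nat.zero_le _) hj)
    exact le_min le_rfl hle
  · push Not at hbig
    refine h1.trans (Finset.sum_le_sum fun j hj => ?_)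
    exact le_min (hbig j hj).le le_rfl

theorem card_met_le (h' : I.History) (s : Finset (Fin I.m)) :
    (s.filter fun j => ∃ a ∈ h', j ∈ I.N a.1).card ≤ h'.length * I.rank := by
  have : (s.filter fun j => ∃ a ∈ h', j ∈ I.N a.1) ⊆ h'.toFinset.biUnion fun a => I.N a.1 := by
    intro j hj
    simpa using (Finset.mem_filter.1 hj).2
  refine (Finset.card_le_card this).trans ((Finset.card_biUnion_le_card_mul _ _ I.rank
    fun a _ => Finset.le_sup (f := fun i => (I.N i).card) (Finset.mem_univ a.1)).trans ?_)
  exact Nat.mul_le_mul_right _ (List.toFinset_card_le _)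

theorem p_mem (I : HGP) (j : Fin I.m) : (0 : ℝ) ≤ I.p j ∧ (I.p j : ℝ) ≤ 1 :=
  ⟨by exact_mod_cast I.p_nonneg j, by exact_mod_cast I.p_le_one j⟩

/-- Every fresh latent variable has expected progress at most that of the greedy choice. -/
theorem exists_bound {π : I.Policy} (hπ : I.IsGreedy π) {h : I.History} (hl : I.Live h)
    (hcl : ¬ I.Closing h) (t : ℕ) : ∃ M : ℝ, 0 ≤ M ∧
      (∀ j ∈ I.fresh h, (I.p j : ℝ) * I.weight h j ≤ M) ∧
      M * ∑ Y, I.prob Y * (if I.hist π Y t = h then 1 else 0) ≤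
        ∑ Y, I.prob Y * ((if I.hist π Y t = h then 1 else 0) * I.progress h (π.next h) Y) := by
  have hP : 0 ≤ ∑ Y, I.prob Y *
      ((if I.hist π Y t = h then (1 : ℝ) else 0) * I.progress h (π.next h) Y) :=
    Finset.sum_nonneg fun Y _ => mul_nonneg (prob_nonneg I Y)
      (mul_nonneg (by split_ifs <;> norm_num) (Nat.cast_nonneg _))
  have hnext : ∀ l ∈ I.N (π.next h), l ∉ I.dead h → ((I.p l : ℝ) * I.weight h l) *
      ∑ Y, I.prob Y * (if I.hist π Y t = h then 1 else 0) ≤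
        ∑ Y, I.prob Y * ((if I.hist π Y t = h then 1 else 0) * I.progress h (π.next h) Y) := by
    intro l hl' hd
    have hf : l ∈ I.fresh h := mem_fresh.2 ⟨⟨_, π.fresh h hl, hl'⟩, hd⟩
    rw [mul_assoc, mul_left_comm, ← sum_prob_mul_of_invariant I l, Finset.mul_sum]
    · refine Finset.sum_le_sum fun Y _ => ?_
      rw [mul_left_comm]
      refine mul_le_mul_of_nonneg_left ?_ (prob_nonneg I Y)
      rw [mul_left_comm]
      refine mul_le_mul_of_nonneg_left ?_ (by split_ifs <;> norm_num)
      have h1 : (if Y l then I.weight h l else 0) ≤ I.progress h (π.next h) Y :=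
        Finset.le_sup (f := fun j => if Y j then I.weight h j else 0) hl'
      have h2 : ((if Y l then I.weight h l else 0 : ℕ) : ℝ) ≤ I.progress h (π.next h) Y := by
        exact_mod_cast h1
      refine le_trans (le_of_eq ?_) h2
      split_ifs <;> simp
    · intro Y b
      simp only [hist_update_eq_iff hcl hf t Y b]
  rcases (I.fresh h).eq_empty_or_nonempty with he | hne
  · exact ⟨0, le_rfl, by simp [he], by simpa using hP⟩
  · obtain ⟨j, hj, hmax⟩ := Finset.exists_max_image (I.fresh h)
      (fun j => (I.p j : ℝ) * I.weight h j) hne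
    refine ⟨(I.p j : ℝ) * I.weight h j, mul_nonneg (p_mem I j).1 (Nat.cast_nonneg _), hmax, ?_⟩
    obtain ⟨⟨i, hi, hji⟩, hd⟩ := mem_fresh.1 hj
    rcases hπ.best h hl hcl i hi j hji hd with h0 | ⟨l, hl', hld, hle⟩
    · have h0 : (I.p j : ℝ) * I.weight h j = 0 := by exact_mod_cast h0
      rw [h0, zero_mul]; exact hP
    · have hle : (I.p j : ℝ) * I.weight h j ≤ I.p l * I.weight h l := by exact_mod_cast hle
      refine le_trans (mul_le_mul_of_nonneg_right hle ?_) (hnext l hl' hld)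
      exact Finset.sum_nonneg fun Y _ => mul_nonneg (prob_nonneg I Y)
        (by split_ifs <;> norm_num)

/-- Conditioned on a history with no pursuit in progress, the expected progress of the greedy step
is at least the fraction `1 / (rank * T)` of the need, times the probability that another policy
succeeds within `T` probes. -/
theorem need_mul_sum_le {π : I.Policy} (hπ : I.IsGreedy π) (π' : I.Policy) {h : I.History}
    (hl : I.Live h) (hcl : ¬ I.Closing h) (t T : ℕ) :
    I.need h * ∑ Y, I.prob Y * ((if I.hist π Y t = h then 1 else 0) *
      (if I.k ≤ (I.hist π' Y T).countP (fun a => a.2) then 1 else 0)) ≤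
      (I.rank * T) * ∑ Y, I.prob Y *
        ((if I.hist π Y t = h then 1 else 0) * I.progress h (π.next h) Y) := by
  obtain ⟨M, hM0, hM, hle⟩ := exists_bound hπ hl hcl t
  have hif : ∀ c : Prop, [Decidable c] → (0 : ℝ) ≤ if c then 1 else 0 := by
    intro c _; split_ifs <;> norm_num
  calc _ ≤ ∑ Y, I.prob Y * ((if I.hist π Y t = h then 1 else 0) * ∑ j ∈ I.fresh h,
          (I.weight h j : ℝ) * ((if ∃ a ∈ I.hist π' Y T, j ∈ I.N a.1 then 1 else 0) *
            if Y j then 1 else 0)) := by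
        rw [Finset.mul_sum]
        refine Finset.sum_le_sum fun Y _ => ?_
        rw [mul_left_comm]
        refine mul_le_mul_of_nonneg_left ?_ (prob_nonneg I Y)
        by_cases hY : I.hist π Y t = h
        · simp only [hY, if_true, one_mul]
          by_cases hk : I.k ≤ (I.hist π' Y T).countP (fun a => a.2)
          · have := need_le_sum_weight (hY ▸ hist_consistent π Y t) (hist_consistent π' Y T) hk
            rw [if_pos hk, mul_one]
            have : (I.need h : ℝ) ≤ ((∑ j ∈ I.fresh h, if (∃ a ∈ I.hist π' Y T, j ∈ I.N a.1) ∧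
              Y j = true then I.weight h j else 0 : ℕ) : ℝ) := by exact_mod_cast this
            refine this.trans (le_of_eq ?_)
            push_cast
            refine Finset.sum_congr rfl fun j _ => ?_
            by_cases h1 : ∃ a ∈ I.hist π' Y T, j ∈ I.N a.1 <;> by_cases h2 : Y j = true <;>
              simp [h1, h2]
          · rw [if_neg hk, mul_zero]
            exact Finset.sum_nonneg fun j _ => mul_nonneg (Nat.cast_nonneg _)
              (mul_nonneg (hif _) (hif _))
        · simp [hY]
    _ = ∑ j ∈ I.fresh h, (I.weight h j : ℝ) * ∑ Y, I.prob Y * (((if I.hist π Y t = h then 1 else 0)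
          * (if ∃ a ∈ I.hist π' Y T, j ∈ I.N a.1 then 1 else 0)) * if Y j then 1 else 0) := by
        simp only [Finset.mul_sum]
        rw [Finset.sum_comm]
        refine Finset.sum_congr rfl fun j _ => Finset.sum_congr rfl fun Y _ => ?_
        ring
    _ = ∑ j ∈ I.fresh h, ((I.p j : ℝ) * I.weight h j) * ∑ Y, I.prob Y *
          ((if I.hist π Y t = h then 1 else 0)
          * (if ∃ a ∈ I.hist π' Y T, j ∈ I.N a.1 then 1 else 0)) := by
        refine Finset.sum_congr rfl fun j hj => ?_
        rw [sum_prob_mul_of_invariant I j]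
        · ring
        · intro Y b
          simp only [hist_update_eq_iff hcl hj t Y b, exists_mem_hist_update_iff T Y j b]
    _ ≤ ∑ j ∈ I.fresh h, M * ∑ Y, I.prob Y *
          ((if I.hist π Y t = h then 1 else 0)
          * (if ∃ a ∈ I.hist π' Y T, j ∈ I.N a.1 then 1 else 0)) := by
        refine Finset.sum_le_sum fun j hj => mul_le_mul_of_nonneg_right (hM j hj) ?_
        exact Finset.sum_nonneg fun Y _ => mul_nonneg (prob_nonneg I Y)
          (mul_nonneg (hif _) (hif _))
    _ = M * ∑ Y, I.prob Y * ((if I.hist π Y t = h then 1 else 0) *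
          ∑ j ∈ I.fresh h, if ∃ a ∈ I.hist π' Y T, j ∈ I.N a.1 then 1 else 0) := by
        rw [← Finset.mul_sum, Finset.sum_comm]
        simp only [Finset.mul_sum]
    _ ≤ M * ∑ Y, I.prob Y * ((if I.hist π Y t = h then 1 else 0) * (I.rank * T)) := by
        refine mul_le_mul_of_nonneg_left (Finset.sum_le_sum fun Y _ => mul_le_mul_of_nonneg_left
          (mul_le_mul_of_nonneg_left ?_ (hif _)) (prob_nonneg I Y)) hM0
        rw [Finset.sum_boole]
        have h1 := card_met_le (I.hist π' Y T) (I.fresh h)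
        have h2 := Nat.mul_le_mul_right I.rank (hist_length_le π' Y T)
        have h3 := h1.trans h2
        rw [mul_comm T] at h3
        exact_mod_cast h3
    _ = (I.rank * T) * (M * ∑ Y, I.prob Y * (if I.hist π Y t = h then 1 else 0)) := by
        simp only [Finset.mul_sum]
        refine Finset.sum_congr rfl fun Y _ => ?_
        ring
    _ ≤ _ := mul_le_mul_of_nonneg_left hle (by positivity)

open Classical in
/-- At the greedy step with index `g`, the indicator that another policy succeeds within `g / α`
probes. -/
noncomputable def success (I : HGP) (π' : I.Policy) (α : ℕ) (h : I.History)
    (Y : Fin I.m → Bool) : ℝ :=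
  if I.Done h ∨ I.Closing h then 0 else
    if I.k ≤ (I.hist π' Y ((I.greedySteps h + 1) / α)).countP (fun a => a.2) then 1 else 0

/-- The expected charge of a step is at least `α / rank` times the probability of the event
`success`. -/
theorem sum_success_le {π : I.Policy} (hπ : I.IsGreedy π) (π' : I.Policy) (α t : ℕ)
    (hr : 1 ≤ I.rank) :
    (α : ℝ) / I.rank * ∑ Y, I.prob Y * I.success π' α (I.hist π Y t) Y ≤
      ∑ Y, I.prob Y * I.charge π (I.hist π Y t) Y := by
  have hr' : (0 : ℝ) < I.rank := by exact_mod_cast hr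
  have hfib : ∀ F : I.History → (Fin I.m → Bool) → ℝ, ∑ Y, I.prob Y * F (I.hist π Y t) Y =
      ∑ h ∈ Finset.univ.image (fun Y => I.hist π Y t),
        ∑ Y, I.prob Y * ((if I.hist π Y t = h then 1 else 0) * F h Y) := by
    intro F
    rw [Finset.sum_comm]
    refine Finset.sum_congr rfl fun Y _ => ?_
    rw [← Finset.mul_sum]
    congr 1
    rw [Finset.sum_eq_single (I.hist π Y t)]
    · simp
    · intro h _ hne; simp [hne.symm]
    · intro hn; exact absurd (Finset.mem_image_of_mem _ (Finset.mem_univ Y)) hn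
  rw [hfib (I.success π' α), hfib (I.charge π), Finset.mul_sum]
  refine Finset.sum_le_sum fun h hh => ?_
  by_cases hdc : I.Done h ∨ I.Closing h
  · simp [success, charge, hdc]
  · obtain ⟨hd, hcl⟩ := not_or.1 hdc
    obtain ⟨Y₀, _, rfl⟩ := Finset.mem_image.1 hh
    have hl : I.Live (I.hist π Y₀ t) := hist_live hd
    set h := I.hist π Y₀ t
    set T := (I.greedySteps h + 1) / α with hT
    have key := need_mul_sum_le hπ π' hl hcl t T
    have hneed : (0 : ℝ) < I.need h := by exact_mod_cast need_pos hd
    have hTα : (α : ℝ) * T ≤ (I.greedySteps h : ℝ) + 1 := by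
      have : α * T ≤ I.greedySteps h + 1 := Nat.mul_div_le _ _
      exact_mod_cast this
    simp only [success, charge, if_neg hdc]
    set A := ∑ Y, I.prob Y * ((if I.hist π Y t = h then (1 : ℝ) else 0) *
      (if I.k ≤ (I.hist π' Y T).countP (fun a => a.2) then 1 else 0)) with hA
    set B := ∑ Y, I.prob Y * ((if I.hist π Y t = h then (1 : ℝ) else 0) *
      I.progress h (π.next h) Y) with hB
    have hB0 : 0 ≤ B := Finset.sum_nonneg fun Y _ => mul_nonneg (prob_nonneg I Y)
      (mul_nonneg (by split_ifs <;> norm_num) (Nat.cast_nonneg _))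
    have hR : ∑ Y, I.prob Y * ((if I.hist π Y t = h then (1 : ℝ) else 0) *
        (((I.greedySteps h : ℝ) + 1) * (I.progress h (π.next h) Y / I.need h))) =
        ((I.greedySteps h : ℝ) + 1) / I.need h * B := by
      rw [hB, Finset.mul_sum]
      refine Finset.sum_congr rfl fun Y _ => ?_
      ring
    rw [hR, div_mul_eq_mul_div, div_mul_eq_mul_div, div_le_div_iff₀ hr' hneed]
    calc α * A * I.need h = α * (I.need h * A) := by ring
      _ ≤ α * ((I.rank * T) * B) := mul_le_mul_of_nonneg_left key (Nat.cast_nonneg _)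
      _ = (α * T) * (B * I.rank) := by ring
      _ ≤ ((I.greedySteps h : ℝ) + 1) * (B * I.rank) :=
        mul_le_mul_of_nonneg_right hTα (by positivity)
      _ = _ := by ring

/-- If there are `k` active variables, then all but `α * cost` of the greedy steps see the other
policy succeed. -/
theorem greedySteps_le_sum_success (π π' : I.Policy) {Y : Fin I.m → Bool} (α t : ℕ) (hα : 0 < α)
    (hY : I.k ≤ (I.actives Y).card) :
    (I.greedySteps (I.hist π Y t) : ℝ) ≤
      ∑ s ∈ Finset.range t, I.success π' α (I.hist π Y s) Y + α * I.cost π' Y := by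
  have h := greedySteps_le π Y (α * I.cost π' Y) t
  have h' : (I.greedySteps (I.hist π Y t) : ℝ) ≤ _ := Nat.cast_le.2 h
  refine h'.trans ?_
  push_cast
  gcongr with s hs
  unfold success
  split_ifs with h1 h2 h3 h3
  · simp
  · simp
  · exfalso
    apply h3
    rw [hist_of_cost_le ((Nat.le_div_iff_mul_le hα).2 (by rwa [mul_comm]))]
    exact le_countP_hist π' hY
  · simp
  · simp

/-- The approximation guarantee of greedy policies. -/
theorem expCost_le_of_isGreedy {π : I.Policy} (hπ : I.IsGreedy π) (π' : I.Policy)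
    (hr : 1 ≤ I.rank) :
    I.expCost π ≤ 10 * (I.rank : ℝ) ^ 2 * (1 + Real.log (I.k : ℝ)) * I.expCost π' := by
  have hk1 : (1 : ℝ) ≤ I.k := by exact_mod_cast I.one_le_k
  have hr1 : (1 : ℝ) ≤ I.rank := by exact_mod_cast hr
  set H := 1 + Real.log (I.k : ℝ) with hH
  have hH1 : 1 ≤ H := by have := Real.log_nonneg hk1; linarith
  set r : ℝ := (I.rank : ℝ)
  set α : ℕ := ⌈2 * r * H⌉₊ with hα
  have hrH : 1 ≤ r * H := one_le_mul_of_one_le_of_one_le hr1 hH1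
  have hα1 : 2 * (r * H) ≤ α := by rw [← mul_assoc]; exact Nat.le_ceil _
  have hα2 : (α : ℝ) ≤ 3 * (r * H) := by
    have := Nat.ceil_lt_add_one (show 0 ≤ 2 * r * H by nlinarith)
    rw [← hα] at this; linarith
  have hα0 : 0 < α := by
    have : (0 : ℝ) < α := by linarith
    exact_mod_cast this
  -- `L` counts greedy steps, and `a` is the indicator of having `k` active variables.
  let L : (Fin I.m → Bool) → ℝ := fun Y => I.greedySteps (I.hist π Y I.n)
  let a : (Fin I.m → Bool) → ℝ := fun Y => if I.k ≤ (I.actives Y).card then 1 else 0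
  let O : (Fin I.m → Bool) → ℝ := fun Y => I.cost π' Y
  have ha : ∀ Y, 0 ≤ a Y := fun Y => by simp only [a]; split_ifs <;> norm_num
  have hO : ∀ Y, 0 ≤ O Y := fun Y => Nat.cast_nonneg _
  have hL : ∀ Y, L Y ≤ I.n := fun Y => by
    have := (greedySteps_le_length (I.hist π Y I.n)).trans (hist_length_le π Y I.n)
    exact Nat.cast_le.2 this
  set L1 := ∑ Y, I.prob Y * (a Y * L Y) with hL1
  set O1 := ∑ Y, I.prob Y * (a Y * O Y) with hO1
  set O2 := ∑ Y, I.prob Y * ((1 - a Y) * O Y) with hO2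
  have hOsum : I.expCost π' = O1 + O2 := by
    rw [hO1, hO2, ← Finset.sum_add_distrib, expCost]
    refine Finset.sum_congr rfl fun Y _ => ?_
    simp only [O]; ring
  have hO1n : 0 ≤ O1 := Finset.sum_nonneg fun Y _ => mul_nonneg (prob_nonneg I Y)
    (mul_nonneg (ha Y) (hO Y))
  have hO2n : 0 ≤ O2 := Finset.sum_nonneg fun Y _ => mul_nonneg (prob_nonneg I Y)
    (mul_nonneg (by simp only [a]; split_ifs <;> norm_num) (hO Y))
  have hsucc : ∀ h Y, 0 ≤ I.success π' α h Y := fun h Y => by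
    unfold success; split_ifs <;> norm_num
  have hlow : L1 - α * O1 ≤
      ∑ s ∈ Finset.range I.n, ∑ Y, I.prob Y * I.success π' α (I.hist π Y s) Y := by
    rw [Finset.sum_comm, hL1, hO1, Finset.mul_sum, ← Finset.sum_sub_distrib]
    refine Finset.sum_le_sum fun Y _ => ?_
    rw [← Finset.mul_sum, mul_left_comm (α : ℝ), ← mul_sub]
    refine mul_le_mul_of_nonneg_left ?_ (prob_nonneg I Y)
    by_cases hY : I.k ≤ (I.actives Y).card
    · have := greedySteps_le_sum_success π π' α I.n hα0 hY
      simp only [a, if_pos hY, L, O]; linarith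
    · simp only [a, if_neg hY, zero_mul, mul_zero, sub_zero]
      exact Finset.sum_nonneg fun s _ => hsucc _ _
  have hup : ∑ s ∈ Finset.range I.n, ∑ Y, I.prob Y * I.charge π (I.hist π Y s) Y ≤
      H * (L1 + O2) := by
    rw [Finset.sum_comm, hL1, hO2, ← Finset.sum_add_distrib, Finset.mul_sum]
    refine Finset.sum_le_sum fun Y _ => ?_
    rw [← Finset.mul_sum, ← mul_add, mul_left_comm]
    refine mul_le_mul_of_nonneg_left ?_ (prob_nonneg I Y)
    refine (sum_charge_le π Y I.n).trans ?_
    refine mul_le_mul (harm_le _) ?_ (Nat.cast_nonneg _) (by linarith)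
    by_cases hY : I.k ≤ (I.actives Y).card
    · simp [a, hY, L]
    · simp only [a, if_neg hY, O, cost_eq_of_card_actives_lt π' (not_le.1 hY)]
      have := hL Y
      simp only [L] at this
      linarith
  have hmid : (α : ℝ) / r * (L1 - α * O1) ≤ H * (L1 + O2) := by
    refine le_trans (mul_le_mul_of_nonneg_left hlow (by positivity)) (le_trans ?_ hup)
    rw [Finset.mul_sum]
    exact Finset.sum_le_sum fun s _ => sum_success_le hπ π' α s hr
  have hL1le : L1 ≤ 2 * α * O1 + O2 := by
    rw [div_mul_eq_mul_div, div_le_iff₀ (by linarith)] at hmid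
    have hL1n : 0 ≤ L1 := Finset.sum_nonneg fun Y _ => mul_nonneg (prob_nonneg I Y)
      (mul_nonneg (ha Y) (Nat.cast_nonneg _))
    have h1 : 2 * (r * H) * (L1 + O2) ≤ α * (L1 + O2) :=
      mul_le_mul_of_nonneg_right hα1 (by linarith)
    have h2 : (α : ℝ) * (L1 - 2 * α * O1 - O2) ≤ 0 := by nlinarith
    have h3 : (0 : ℝ) < α := by exact_mod_cast hα0
    nlinarith [nonpos_of_mul_nonpos_right h2 h3]
  have hcost : I.expCost π ≤ (1 + r) * O1 + L1 + O2 := by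
    rw [hO1, hO2, hL1, Finset.mul_sum, ← Finset.sum_add_distrib, ← Finset.sum_add_distrib, expCost]
    refine Finset.sum_le_sum fun Y _ => ?_
    rw [mul_left_comm, ← mul_add, ← mul_add]
    refine mul_le_mul_of_nonneg_left ?_ (prob_nonneg I Y)
    by_cases hY : I.k ≤ (I.actives Y).card
    · have h1 := cost_le_add_greedySteps π hπ Y
      have h1' : (I.cost π Y : ℝ) ≤ I.k + L Y + I.k * r := by
        change (I.cost π Y : ℝ) ≤ I.k + (I.greedySteps (I.hist π Y I.n) : ℝ) + I.k * (I.rank : ℝ)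
        exact_mod_cast h1
      have h2 : (I.k : ℝ) ≤ O Y := Nat.cast_le.2 (k_le_cost π' hY)
      simp only [a, if_pos hY]
      nlinarith
    · simp only [a, if_neg hY, O, cost_eq_of_card_actives_lt π' (not_le.1 hY),
        cost_eq_of_card_actives_lt π (not_le.1 hY)]
      linarith
  rw [hOsum]
  have hrr : r * H ≤ r ^ 2 * H := by nlinarith
  have h1 : (1 + r) * O1 + (2 * α * O1 + O2) + O2 ≤ 10 * (r * H) * (O1 + O2) := by
    have hrle : r ≤ r * H := by nlinarith
    have e1 : r * O1 ≤ (r * H) * O1 := mul_le_mul_of_nonneg_right hrle hO1n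
    have e2 : 1 * O1 ≤ (r * H) * O1 := mul_le_mul_of_nonneg_right hrH hO1n
    have e3 : (α : ℝ) * O1 ≤ 3 * (r * H) * O1 := mul_le_mul_of_nonneg_right hα2 hO1n
    have e4 : 1 * O2 ≤ (r * H) * O2 := mul_le_mul_of_nonneg_right hrH hO2n
    nlinarith
  have h2 : 10 * (r * H) * (O1 + O2) ≤ 10 * (r ^ 2 * H) * (O1 + O2) :=
    mul_le_mul_of_nonneg_right (by linarith) (by linarith)
  linarith

end HGP

/-! ### Functions computable in polynomial time -/

/-- Types whose elements are coded by trees. -/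
class Enc (α : Type) where
  enc : α → Val

namespace Enc

instance : Enc ℕ := ⟨Val.num⟩
instance : Enc Bool := ⟨fun b => .num b.toNat⟩
instance {α β : Type} [Enc α] [Enc β] : Enc (α × β) := ⟨fun x => .pair (enc x.1) (enc x.2)⟩
instance {α : Type} [Enc α] : Enc (List α) := ⟨fun l => Val.ofList (l.map enc)⟩

/-- The bit size of the code. -/
def esize {α : Type} [Enc α] (a : α) : ℕ := (enc a).size

variable {α β : Type} [Enc α] [Enc β]

theorem esize_pair (a : α) (b : β) : esize (a, b) = esize a + esize b + 1 := rfl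

theorem esize_num (n : ℕ) : esize n = Nat.size n + 1 := rfl

theorem esize_nil : esize ([] : List α) = 1 := by simp [esize, enc, Val.ofList, Val.size]

theorem esize_cons (a : α) (l : List α) : esize (a :: l) = esize a + esize l + 1 := rfl

theorem esize_bool_le (b : Bool) : esize b ≤ 2 := by
  cases b <;> simp [esize, enc, Val.size]

theorem length_le_esize (l : List α) : l.length ≤ esize l := by
  induction l with
  | nil => simp
  | cons a l ih => rw [esize_cons, List.length_cons]; omega

theorem esize_le_append (l₁ l₂ : List α) :
    esize l₁ ≤ esize (l₁ ++ l₂) ∧ esize l₂ ≤ esize (l₁ ++ l₂) := by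
  induction l₁ with
  | nil =>
    refine ⟨?_, le_rfl⟩
    rw [esize_nil, List.nil_append]
    cases l₂ with
    | nil => rw [esize_nil]
    | cons a l₂ => rw [esize_cons]; omega
  | cons a l₁ ih => rw [List.cons_append, esize_cons, esize_cons]; omega

theorem esize_le_of_mem {a : α} {l : List α} (h : a ∈ l) : esize a ≤ esize l := by
  induction l with
  | nil => cases h
  | cons b l ih =>
    rw [esize_cons]
    rcases List.mem_cons.1 h with rfl | h
    · omega
    · have := ih h; omega

end Enc

open Enc

theorem Runs.size_le {P : Prog} {x y : Val} {t : ℕ} (h : Runs P x y t) :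
    x.size ≤ t ∧ y.size ≤ t := by
  induction h <;> (try simp only [Val.size] at *) <;> omega

theorem Polynomial.eval_nat_mono (q : Polynomial ℕ) : Monotone fun n : ℕ => q.eval n := by
  intro a b hab
  simp only [Polynomial.eval_eq_sum_range]
  gcongr

/-- A function is computable in polynomial time (with respect to the codes). -/
def PolyTime {α β : Type} [Enc α] [Enc β] (f : α → β) : Prop :=
  ∃ (P : Prog) (q : Polynomial ℕ), ∀ a, ∃ t ≤ q.eval (esize a), Runs P (enc a) (enc (f a)) t

theorem nat_size_add_le (a b : ℕ) : Nat.size (a + b) ≤ Nat.size a + Nat.size b + 1 := by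
  have ha := Nat.lt_size_self a
  have hb := Nat.lt_size_self b
  rw [Nat.size_le]
  have h1 : 2 ^ a.size ≤ 2 ^ (a.size + b.size) := Nat.pow_le_pow_right (by norm_num) (by omega)
  have h2 : 2 ^ b.size ≤ 2 ^ (a.size + b.size) := Nat.pow_le_pow_right (by norm_num) (by omega)
  rw [pow_succ]
  omega

theorem nat_size_mul_le (a b : ℕ) : Nat.size (a * b) ≤ Nat.size a + Nat.size b := by
  rw [Nat.size_le, pow_add]
  exact Nat.mul_lt_mul'' (Nat.lt_size_self a) (Nat.lt_size_self b)

namespace PolyTime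

variable {α β γ δ : Type} [Enc α] [Enc β] [Enc γ] [Enc δ]

theorem exists_esize_le {f : α → β} (hf : PolyTime f) :
    ∃ q : Polynomial ℕ, ∀ a, esize (f a) ≤ q.eval (esize a) := by
  obtain ⟨P, q, h⟩ := hf
  refine ⟨q, fun a => ?_⟩
  obtain ⟨t, ht, hr⟩ := h a
  exact hr.size_le.2.trans ht

theorem congr {f g : α → β} (hf : PolyTime f) (h : ∀ a, f a = g a) : PolyTime g :=
  funext h ▸ hf

theorem of_op (o : Op) {f : α → β} (hf : ∀ a, o.eval (enc a) = enc (f a)) (q : Polynomial ℕ)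
    (hq : ∀ a, esize (f a) ≤ q.eval (esize a)) : PolyTime f := by
  refine ⟨.op o, Polynomial.X + q + 1, fun a => ⟨_, ?_, hf a ▸ Runs.op o (enc a)⟩⟩
  have := hq a
  simp only [Polynomial.eval_add, Polynomial.eval_X, Polynomial.eval_one]
  unfold esize at *
  omega

protected theorem id : PolyTime (fun a : α => a) :=
  of_op .id (fun _ => rfl) Polynomial.X (by simp)

protected theorem const (b : β) : PolyTime (fun _ : α => b) :=
  of_op (.const (enc b)) (fun _ => rfl) (Polynomial.C (esize b)) (by simp)

theorem comp {g : β → γ} {f : α → β} (hg : PolyTime g) (hf : PolyTime f) :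
    PolyTime fun a => g (f a) := by
  obtain ⟨P, q, hP⟩ := hf
  obtain ⟨Q, r, hQ⟩ := hg
  refine ⟨.comp P Q, q + r.comp q + 1, fun a => ?_⟩
  obtain ⟨t, ht, h1⟩ := hP a
  obtain ⟨u, hu, h2⟩ := hQ (f a)
  refine ⟨_, ?_, Runs.comp h1 h2⟩
  have := Polynomial.eval_nat_mono r (h1.size_le.2.trans ht)
  simp only [Polynomial.eval_add, Polynomial.eval_comp, Polynomial.eval_one]
  simp only [esize] at *
  omega

theorem pair {f : α → β} {g : α → γ} (hf : PolyTime f) (hg : PolyTime g) :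
    PolyTime fun a => (f a, g a) := by
  obtain ⟨P, q, hP⟩ := hf
  obtain ⟨Q, r, hQ⟩ := hg
  refine ⟨.pair P Q, q + r + 1, fun a => ?_⟩
  obtain ⟨t, ht, h1⟩ := hP a
  obtain ⟨u, hu, h2⟩ := hQ a
  refine ⟨_, ?_, Runs.pair h1 h2⟩
  simp only [Polynomial.eval_add, Polynomial.eval_one]
  omega

theorem fst {f : α → β × γ} (hf : PolyTime f) : PolyTime fun a => (f a).1 :=
  comp (g := fun x : β × γ => x.1) (of_op .fst (fun _ => rfl) Polynomial.X (by
    rintro ⟨b, c⟩; simp only [Polynomial.eval_X, esize_pair]; omega)) hf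

theorem snd {f : α → β × γ} (hf : PolyTime f) : PolyTime fun a => (f a).2 :=
  comp (g := fun x : β × γ => x.2) (of_op .snd (fun _ => rfl) Polynomial.X (by
    rintro ⟨b, c⟩; simp only [Polynomial.eval_X, esize_pair]; omega)) hf

theorem ite {c : α → Bool} {f g : α → β} (hc : PolyTime c) (hf : PolyTime f) (hg : PolyTime g) :
    PolyTime fun a => if c a then f a else g a := by
  obtain ⟨R, s, hR⟩ := hc
  obtain ⟨P, q, hP⟩ := hf
  obtain ⟨Q, r, hQ⟩ := hg
  refine ⟨.ite R P Q, s + q + r + 1, fun a => ?_⟩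
  obtain ⟨t, ht, h1⟩ := hR a
  simp only [Polynomial.eval_add, Polynomial.eval_one]
  by_cases h : c a = true
  · obtain ⟨u, hu, h2⟩ := hP a
    rw [h] at h1
    simp only [h, if_true]
    exact ⟨_, by omega, Runs.ite_true h1 (by simp [enc]) h2⟩
  · obtain ⟨u, hu, h2⟩ := hQ a
    rw [Bool.not_eq_true] at h
    rw [h] at h1
    simp only [h, Bool.false_eq_true, if_false]
    exact ⟨_, by omega, Runs.ite_false h1 h2⟩

theorem not {c : α → Bool} (hc : PolyTime c) : PolyTime fun a => !c a := by
  have := ite hc (PolyTime.const false) (PolyTime.const true)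
  refine PolyTime.congr (this) fun a => ?_
  cases c a <;> rfl

theorem and {c d : α → Bool} (hc : PolyTime c) (hd : PolyTime d) : PolyTime fun a => c a && d a := by
  have := ite hc hd (PolyTime.const false)
  refine PolyTime.congr (this) fun a => ?_
  cases c a <;> rfl

theorem add {f g : α → ℕ} (hf : PolyTime f) (hg : PolyTime g) : PolyTime fun a => f a + g a :=
  comp (g := fun x : ℕ × ℕ => x.1 + x.2) (of_op .add (fun _ => rfl) Polynomial.X (by
    rintro ⟨a, b⟩
    have := nat_size_add_le a b
    simp only [Polynomial.eval_X, esize_pair, esize_num]; omega)) (hf.pair hg)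

theorem sub {f g : α → ℕ} (hf : PolyTime f) (hg : PolyTime g) : PolyTime fun a => f a - g a :=
  comp (g := fun x : ℕ × ℕ => x.1 - x.2) (of_op .sub (fun _ => rfl) Polynomial.X (by
    rintro ⟨a, b⟩
    have := Nat.size_le_size (Nat.sub_le a b)
    simp only [Polynomial.eval_X, esize_pair, esize_num]; omega)) (hf.pair hg)

theorem mul {f g : α → ℕ} (hf : PolyTime f) (hg : PolyTime g) : PolyTime fun a => f a * g a :=
  comp (g := fun x : ℕ × ℕ => x.1 * x.2) (of_op .mul (fun _ => rfl) Polynomial.X (by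
    rintro ⟨a, b⟩
    have := nat_size_mul_le a b
    simp only [Polynomial.eval_X, esize_pair, esize_num]; omega)) (hf.pair hg)

theorem min {f g : α → ℕ} (hf : PolyTime f) (hg : PolyTime g) :
    PolyTime fun a => min (f a) (g a) := by
  refine PolyTime.congr (hf.sub (hf.sub hg)) fun a => ?_
  omega

theorem eq_zero {f : α → ℕ} (hf : PolyTime f) : PolyTime fun a => decide (f a = 0) := by
  refine comp (g := fun n : ℕ => decide (n = 0)) ?_ hf
  refine ⟨.ite (.op .id) (.op (.const (.num 0))) (.op (.const (.num 1))),
    3 * Polynomial.X + 5, fun n => ?_⟩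
  have e : esize n = Nat.size n + 1 := rfl
  simp only [Polynomial.eval_add, Polynomial.eval_mul, Polynomial.eval_X,
    Polynomial.eval_ofNat]
  by_cases h : n = 0
  · subst h
    exact ⟨_, by simp [esize, enc, Op.eval, Val.size],
      Runs.ite_false (Runs.op .id _) (Runs.op (.const (.num 1)) _)⟩
  · have hr := Runs.ite_true (q := .op (.const (.num 1))) (Runs.op .id (.num n))
      (by simpa [Op.eval] using h) (Runs.op (.const (.num 0)) (.num n))
    have hd : enc (decide (n = 0)) = .num 0 := by simp [enc, h]
    rw [hd]
    refine ⟨_, ?_, hr⟩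
    simp [e, Op.eval, Val.size]
    omega

theorem le {f g : α → ℕ} (hf : PolyTime f) (hg : PolyTime g) :
    PolyTime fun a => decide (f a ≤ g a) := by
  refine PolyTime.congr ((hf.sub hg).eq_zero) fun a => ?_
  exact decide_eq_decide.2 Nat.sub_eq_zero_iff_le

theorem eq {f g : α → ℕ} (hf : PolyTime f) (hg : PolyTime g) :
    PolyTime fun a => decide (f a = g a) := by
  refine PolyTime.congr ((hf.le hg).and (hg.le hf)) fun a => ?_
  rw [← Bool.decide_and]
  exact decide_eq_decide.2 (by omega)

theorem cons {f : α → β} {g : α → List β} (hf : PolyTime f) (hg : PolyTime g) :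
    PolyTime fun a => f a :: g a := hf.pair hg

theorem isCons {f : α → List β} (hf : PolyTime f) : PolyTime fun a => !(f a).isEmpty :=
  comp (g := fun l : List β => !l.isEmpty) (of_op .isPair (by rintro (_ | ⟨a, l⟩) <;> rfl) 2 (by
    intro l
    simp only [Polynomial.eval_ofNat]
    exact esize_bool_le _)) hf

/-- The loop that folds over a list: the state consists of a constant, the rest of the list and
the accumulated value. -/
theorem runs_fold {f : γ × (α × β) → β} {P Q : Prog} {q r : Polynomial ℕ}
    (hP : ∀ a : γ × ((α × List α) × β), ∃ t ≤ q.eval (esize a),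
      Runs P (enc a) (enc (a.1, (a.2.1.2, f (a.1, (a.2.1.1, a.2.2))))) t)
    (hQ : ∀ a : γ × (List α × β), ∃ t ≤ r.eval (esize a),
      Runs Q (enc a) (enc (!a.2.1.isEmpty)) t) (c : γ) (M : ℕ) (l : List α) (b : β)
    (hM : ∀ l₁ l₂, l = l₁ ++ l₂ →
      esize (c, (l₂, l₁.foldl (fun b a => f (c, (a, b))) b)) ≤ M) :
    ∃ t ≤ (l.length + 1) * (q.eval M + r.eval M + 1), Runs (.loop Q P) (enc (c, (l, b)))
      (enc (c, (([] : List α), l.foldl (fun b a => f (c, (a, b))) b))) t := by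
  induction l generalizing b with
  | nil =>
    obtain ⟨t, ht, h⟩ := hQ (c, ([], b))
    refine ⟨_, ?_, Runs.loop_stop h⟩
    have := Polynomial.eval_nat_mono r (hM [] [] rfl)
    simp only [List.foldl_nil] at this
    simp only [List.length_nil]
    omega
  | cons a l ih =>
    obtain ⟨t, ht, h⟩ := hQ (c, (a :: l, b))
    obtain ⟨u, hu, h'⟩ := hP (c, ((a, l), b))
    obtain ⟨v, hv, h''⟩ := ih (f (c, (a, b))) fun l₁ l₂ hl =>
      hM (a :: l₁) l₂ (by rw [hl, List.cons_append])
    refine ⟨_, ?_, Runs.loop_step h (by simp [enc]) h' h''⟩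
    have h1 := Polynomial.eval_nat_mono r (hM [] (a :: l) rfl)
    have h2 := Polynomial.eval_nat_mono q (hM [] (a :: l) rfl)
    have h3 : esize (c, ((a, l), b)) = esize (c, (a :: l, b)) := rfl
    simp only [List.foldl_nil] at h1 h2
    rw [h3] at hu
    rw [List.length_cons, add_mul (l.length + 1) 1]
    omega

/-- Folding over a list takes polynomial time if the accumulated values have polynomial size. -/
theorem foldl {L : γ → List α} {B : γ → β} {f : γ × (α × β) → β} (hL : PolyTime L)
    (hB : PolyTime B) (hf : PolyTime f)
    (hs : ∃ s : Polynomial ℕ, ∀ c, ∀ l, l <+: L c →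
      esize (l.foldl (fun b a => f (c, (a, b))) (B c)) ≤ s.eval (esize c)) :
    PolyTime fun c => (L c).foldl (fun b a => f (c, (a, b))) (B c) := by
  obtain ⟨s, hs⟩ := hs
  obtain ⟨sL, hsL⟩ := hL.exists_esize_le
  have hbody : PolyTime fun a : γ × ((α × List α) × β) =>
      (a.1, (a.2.1.2, f (a.1, (a.2.1.1, a.2.2)))) :=
    PolyTime.id.fst.pair (PolyTime.id.snd.fst.snd.pair
      (hf.comp (PolyTime.id.fst.pair (PolyTime.id.snd.fst.fst.pair PolyTime.id.snd.snd))))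
  obtain ⟨P, q, hP⟩ := hbody
  have hcond : PolyTime fun a : γ × (List α × β) => !a.2.1.isEmpty := PolyTime.id.snd.fst.isCons
  obtain ⟨Q, r, hQ⟩ := hcond
  have hinit : PolyTime fun c => (c, (L c, B c)) := PolyTime.id.pair (hL.pair hB)
  obtain ⟨P₀, q₀, hP₀⟩ := hinit
  have hend : PolyTime fun a : γ × (List α × β) => a.2.2 := PolyTime.id.snd.snd
  obtain ⟨P₁, q₁, hP₁⟩ := hend
  let m : Polynomial ℕ := Polynomial.X + sL + s + 2
  refine ⟨.comp P₀ (.comp (.loop Q P) P₁),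
    q₀ + ((sL + 1) * (q.comp m + r.comp m + 1) + q₁.comp m + 1) + 1, fun c => ?_⟩
  obtain ⟨t₀, ht₀, h₀⟩ := hP₀ c
  have hM : ∀ l₁ l₂, L c = l₁ ++ l₂ →
      esize (c, (l₂, l₁.foldl (fun b a => f (c, (a, b))) (B c))) ≤ m.eval (esize c) := by
    intro l₁ l₂ hl
    have h1 := hs c l₁ ⟨l₂, hl.symm⟩
    have h2 : esize l₂ ≤ esize (L c) := by
      rw [hl]; exact (esize_le_append _ _).2
    have h3 := hsL c
    simp only [esize_pair, m, Polynomial.eval_add, Polynomial.eval_X, Polynomial.eval_ofNat]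
    omega
  obtain ⟨t, ht, h⟩ := runs_fold hP hQ c (m.eval (esize c)) (L c) (B c) hM
  obtain ⟨t₁, ht₁, h₁⟩ := hP₁ (c, ([], (L c).foldl (fun b a => f (c, (a, b))) (B c)))
  refine ⟨_, ?_, Runs.comp h₀ (Runs.comp h h₁)⟩
  have h2 := Polynomial.eval_nat_mono q₁ (hM (L c) [] (by simp))
  simp only at h2
  have h3 : ((L c).length + 1) * (q.eval (m.eval (esize c)) + r.eval (m.eval (esize c)) + 1) ≤
      (sL.eval (esize c) + 1) * (q.eval (m.eval (esize c)) + r.eval (m.eval (esize c)) + 1) :=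
    Nat.mul_le_mul_right _ (Nat.succ_le_succ ((length_le_esize _).trans (hsL c)))
  simp only [Polynomial.eval_add, Polynomial.eval_mul, Polynomial.eval_comp, Polynomial.eval_one]
  omega

/-- A fold takes polynomial time if every step increases the size of the accumulated value by an
amount that does not depend on this value. -/
theorem foldl_of_add {L : γ → List α} {B : γ → β} {f : γ × (α × β) → β} (hL : PolyTime L)
    (hB : PolyTime B) (hf : PolyTime f) (r : Polynomial ℕ)
    (hr : ∀ c a b, esize (f (c, (a, b))) ≤ esize b + r.eval (esize (c, a))) :
    PolyTime fun c => (L c).foldl (fun b a => f (c, (a, b))) (B c) := by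
  refine foldl hL hB hf ?_
  obtain ⟨sL, hsL⟩ := hL.exists_esize_le
  obtain ⟨sB, hsB⟩ := hB.exists_esize_le
  refine ⟨sB + sL * r.comp (Polynomial.X + sL + 1), fun c l hl => ?_⟩
  have key : ∀ (l : List α) (b : β), (∀ a ∈ l, esize a ≤ sL.eval (esize c)) →
      esize (l.foldl (fun b a => f (c, (a, b))) b) ≤
        esize b + l.length * r.eval (esize c + sL.eval (esize c) + 1) := by
    intro l
    induction l with
    | nil => intro b _; simp
    | cons a l ih =>
      intro b h
      have h1 := ih (f (c, (a, b))) fun a' ha' => h a' (List.mem_cons_of_mem _ ha')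
      have h2 := hr c a b
      have h3 : r.eval (esize (c, a)) ≤ r.eval (esize c + sL.eval (esize c) + 1) :=
        Polynomial.eval_nat_mono r (by
          have := h a List.mem_cons_self
          rw [esize_pair]; omega)
      rw [List.foldl_cons, List.length_cons, add_mul, one_mul]
      omega
  have h1 := key l (B c) fun a ha => (esize_le_of_mem (hl.subset ha)).trans (hsL c)
  have h2 := hsB c
  have h3 : l.length ≤ sL.eval (esize c) :=
    (hl.length_le.trans (length_le_esize _)).trans (hsL c)
  have h4 := Nat.mul_le_mul_right (r.eval (esize c + sL.eval (esize c) + 1)) h3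
  simp only [Polynomial.eval_add, Polynomial.eval_mul, Polynomial.eval_comp, Polynomial.eval_one,
    Polynomial.eval_X]
  omega

theorem any {L : γ → List α} {p : γ × α → Bool} (hL : PolyTime L) (hp : PolyTime p) :
    PolyTime fun c => (L c).any fun a => p (c, a) := by
  have h := foldl_of_add (f := fun x : γ × (α × Bool) => if p (x.1, x.2.1) then true else x.2.2) hL
    (PolyTime.const false) (ite (hp.comp (PolyTime.id.fst.pair PolyTime.id.snd.fst))
      (PolyTime.const true) PolyTime.id.snd.snd) 2 (by
        intro c a b
        have h1 := esize_bool_le true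
        simp only [Polynomial.eval_ofNat]
        split_ifs <;> omega)
  refine PolyTime.congr (h) fun c => ?_
  have key : ∀ (l : List α) (b : Bool), l.foldl (fun b a => if p (c, a) then true else b) b =
      (b || l.any fun a => p (c, a)) := by
    intro l
    induction l with
    | nil => simp
    | cons a l ih =>
      intro b
      rw [List.foldl_cons, ih, List.any_cons]
      cases p (c, a) <;> simp
  simpa using key (L c) false

theorem countP {L : γ → List α} {p : γ × α → Bool} (hL : PolyTime L) (hp : PolyTime p) :
    PolyTime fun c => (L c).countP fun a => p (c, a) := by
  have h := foldl_of_add (f := fun x : γ × (α × ℕ) => if p (x.1, x.2.1) then x.2.2 + 1 else x.2.2)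
    hL (PolyTime.const 0) (ite (hp.comp (PolyTime.id.fst.pair PolyTime.id.snd.fst))
      (PolyTime.id.snd.snd.add (PolyTime.const 1)) PolyTime.id.snd.snd) 2 (by
        intro c a b
        have h1 := nat_size_add_le b 1
        have h2 : Nat.size 1 = 1 := by simp
        simp only [Polynomial.eval_ofNat]
        split_ifs <;> simp only [esize_num] <;> omega)
  refine PolyTime.congr (h) fun c => ?_
  have key : ∀ (l : List α) (b : ℕ), l.foldl (fun b a => if p (c, a) then b + 1 else b) b =
      b + l.countP fun a => p (c, a) := by
    intro l
    induction l with
    | nil => simp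
    | cons a l ih =>
      intro b
      rw [List.foldl_cons, ih, List.countP_cons]
      split_ifs <;> omega
  simpa using key (L c) 0

/-- Selecting the (last) element of a list with a given property. -/
theorem select {L : γ → List α} {p : γ × α → Bool} {g : α → β} (b₀ : β) (hL : PolyTime L)
    (hp : PolyTime p) (hg : PolyTime g) :
    PolyTime fun c => (L c).foldl (fun b a => if p (c, a) then g a else b) b₀ := by
  obtain ⟨q, hq⟩ := hg.exists_esize_le
  refine foldl_of_add (f := fun x : γ × (α × β) => if p (x.1, x.2.1) then g x.2.1 else x.2.2)
    hL (PolyTime.const b₀) (ite (hp.comp (PolyTime.id.fst.pair PolyTime.id.snd.fst))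
      (hg.comp PolyTime.id.snd.fst) PolyTime.id.snd.snd) q ?_
  intro c a b
  have h1 := hq a
  have h2 : q.eval (esize a) ≤ q.eval (esize (c, a)) :=
    Polynomial.eval_nat_mono q (by rw [esize_pair]; omega)
  simp only
  split_ifs <;> omega

end PolyTime

theorem foldl_select {α β : Type} (p : α → Bool) (g : α → β) (l : List α) (b : β)
    (h : ∃ a ∈ l, p a = true) :
    ∃ a ∈ l, p a = true ∧ l.foldl (fun b a => if p a then g a else b) b = g a := by
  induction l using List.reverseRecOn with
  | nil => simp at h
  | append_singleton l a ih =>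
    rw [List.foldl_append, List.foldl_cons, List.foldl_nil]
    by_cases ha : p a = true
    · exact ⟨a, by simp, ha, by simp [ha]⟩
    · obtain ⟨a', ha', hp⟩ := h
      have hne : a' ∈ l := by
        rcases List.mem_append.1 ha' with h1 | h1
        · exact h1
        · rw [List.mem_singleton] at h1; subst h1; exact absurd hp ha
      obtain ⟨a'', h1, h2, h3⟩ := ih ⟨a', hne, hp⟩
      exact ⟨a'', List.mem_append_left _ h1, h2, by rw [if_neg ha, h3]⟩

/-- The elements of a list with their indices, the last one first. -/
def enumRev {α : Type} (l : List α) : List (ℕ × α) :=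
  (l.foldl (fun b a => (b.1 + 1, (b.1, a) :: b.2)) (0, [])).2

theorem foldl_enum {α : Type} (l : List α) (n : ℕ) (out : List (ℕ × α)) :
    l.foldl (fun b a => (b.1 + 1, (b.1, a) :: b.2)) (n, out) =
      (n + l.length, ((l.zipIdx n).map Prod.swap).reverse ++ out) := by
  induction l generalizing n out with
  | nil => simp
  | cons a l ih =>
    rw [List.foldl_cons, ih]
    simp [List.zipIdx_cons]
    omega

theorem enumRev_eq {α : Type} (l : List α) :
    enumRev l = (l.zipIdx.map Prod.swap).reverse := by
  rw [enumRev, foldl_enum, List.append_nil]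

theorem enumRev_ofFn {α : Type} {n : ℕ} (f : Fin n → α) :
    enumRev (List.ofFn f) = (List.ofFn fun i => (i.val, f i)).reverse := by
  rw [enumRev_eq]
  congr 1
  apply List.ext_getElem <;> simp

theorem PolyTime.enumRev {α γ : Type} [Enc α] [Enc γ] {L : γ → List α} (hL : PolyTime L) :
    PolyTime fun c => enumRev (L c) := by
  obtain ⟨sL, hsL⟩ := hL.exists_esize_le
  refine (foldl (f := fun x : γ × (α × (ℕ × List (ℕ × α))) =>
    (x.2.2.1 + 1, (x.2.2.1, x.2.1) :: x.2.2.2)) hL (PolyTime.const (0, []))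
    ((PolyTime.id.snd.snd.fst.add (PolyTime.const 1)).pair
      ((PolyTime.id.snd.snd.fst.pair PolyTime.id.snd.fst).cons PolyTime.id.snd.snd.snd)) ?_).snd
  refine ⟨2 * sL + sL * (sL + 5) + 4, fun c l hl => ?_⟩
  have key : ∀ (l : List α) (n N : ℕ) (out : List (ℕ × α)), n + l.length ≤ N →
      esize (l.foldl (fun b a => (b.1 + 1, (b.1, a) :: b.2)) (n, out)) ≤
        N + 2 + esize out + esize l + l.length * (N + 5) := by
    intro l
    induction l with
    | nil =>
      intro n N out hn
      have : Nat.size n ≤ n := Nat.size_le.2 Nat.lt_two_pow_self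
      simp only [List.foldl_nil, esize_pair, esize_num, List.length_nil] at *
      omega
    | cons a l ih =>
      intro n N out hn
      rw [List.length_cons] at hn
      have h1 := ih (n + 1) N ((n, a) :: out) (by omega)
      have : Nat.size n ≤ n := Nat.size_le.2 Nat.lt_two_pow_self
      have h2 : esize ((n, a) :: out) = Nat.size n + 1 + esize a + 1 + esize out + 1 := rfl
      rw [h2] at h1
      simp only [List.foldl_cons]
      rw [List.length_cons, add_mul, one_mul, esize_cons]
      omega
  have hlen : l.length ≤ sL.eval (esize c) :=
    (hl.length_le.trans (length_le_esize _)).trans (hsL c)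
  have hsz : esize l ≤ sL.eval (esize c) := by
    refine le_trans ?_ (hsL c)
    obtain ⟨l₂, h⟩ := hl
    rw [← h]
    exact (esize_le_append _ _).1
  have h1 := key l 0 (sL.eval (esize c)) [] (by omega)
  have h2 := Nat.mul_le_mul_right (sL.eval (esize c) + 5) hlen
  rw [esize_nil] at h1
  simp only [Polynomial.eval_add, Polynomial.eval_mul, Polynomial.eval_ofNat]
  omega

/-! ### The algorithm -/

/-- Instances and histories as they are presented to the algorithm: the required number, the
probabilities as fractions, the hyperedges, and the history. -/
abbrev Input : Type := (ℕ × (List (ℕ × ℕ) × List (List ℕ))) × List (ℕ × Bool)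

namespace Input

/-- The hyperedges with their indices. -/
def edges (x : Input) : List (ℕ × List ℕ) := enumRev x.1.2.2

/-- The probabilities of the latent variables with their indices. -/
def latents (x : Input) : List (ℕ × (ℕ × ℕ)) := enumRev x.1.2.1

/-- Membership in a list of numbers. -/
def has (y : List ℕ × ℕ) : Bool := y.1.any fun a => decide (a = y.2)

/-- The observed variable has been probed. -/
def probed (y : Input × ℕ) : Bool := y.1.2.any fun a => decide (a.1 = y.2)

/-- The observed variable has been probed, with the given outcome. -/
def found (b : Bool) (y : Input × ℕ) : Bool :=
  y.1.2.any fun a => decide (a.1 = y.2) && if a.2 then b else !b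

/-- The latent variable lies in a hyperedge that has been probed, with the given outcome. -/
def seen (b : Bool) (y : Input × ℕ) : Bool :=
  y.1.edges.any fun e => found b (y.1, e.1) && has (e.2, y.2)

/-- The number of observed variables above a latent variable that have not been probed. -/
def aboveCount (y : Input × ℕ) : ℕ :=
  y.1.edges.countP fun e => !probed (y.1, e.1) && has (e.2, y.2)

/-- The number of active variables still to be found. -/
def need (x : Input) : ℕ := x.1.1 - x.2.countP fun a => a.2

/-- The score of a latent variable as a fraction: zero if it is known to be inactive, larger than
all expected progresses if it is to be pursued, and otherwise its expected progress. -/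
def score (y : Input × (ℕ × (ℕ × ℕ))) : ℕ × ℕ :=
  if seen false (y.1, y.2.1) then (0, 1) else
    if seen true (y.1, y.2.1) then (y.1.1.1 + 1, 1) else
      (y.2.2.1 * min y.1.need (aboveCount (y.1, y.2.1)), y.2.2.2)

/-- Some latent variable in the hyperedge has at least the given score. -/
def attains (y : (Input × List ℕ) × (ℕ × ℕ)) : Bool :=
  y.1.1.latents.any fun l => has (y.1.2, l.1) &&
    decide (y.2.1 * (score (y.1.1, l)).2 ≤ (score (y.1.1, l)).1 * y.2.2)

/-- Some latent variable in `e` has a positive score that no latent variable in `N` attains. -/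
def beats (y : (Input × List ℕ) × List ℕ) : Bool :=
  y.1.1.latents.any fun l => has (y.2, l.1) &&
    (!decide ((score (y.1.1, l)).1 = 0) && !attains (y.1, score (y.1.1, l)))

/-- The hyperedge has not been probed, and no other such hyperedge beats it. -/
def good (y : Input × (ℕ × List ℕ)) : Bool :=
  !probed (y.1, y.2.1) &&
    !y.1.edges.any fun e => !probed (y.1, e.1) && beats ((y.1, y.2.2), e.2)

/-- The variable to be probed next. -/
def choice (x : Input) : ℕ :=
  x.edges.foldl (fun b e => if good (x, e) then e.1 else b) 0

theorem polyTime_edges : PolyTime edges := PolyTime.id.fst.snd.snd.enumRev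

theorem polyTime_latents : PolyTime latents := PolyTime.id.fst.snd.fst.enumRev

theorem polyTime_has : PolyTime has :=
  PolyTime.id.fst.any (p := fun z : (List ℕ × ℕ) × ℕ => decide (z.2 = z.1.2))
    (PolyTime.id.snd.eq PolyTime.id.fst.snd)

theorem polyTime_probed : PolyTime probed :=
  PolyTime.id.fst.snd.any (p := fun z : (Input × ℕ) × (ℕ × Bool) => decide (z.2.1 = z.1.2))
    (PolyTime.id.snd.fst.eq PolyTime.id.fst.snd)

theorem polyTime_found (b : Bool) : PolyTime (found b) :=
  PolyTime.id.fst.snd.any (p := fun z : (Input × ℕ) × (ℕ × Bool) =>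
      decide (z.2.1 = z.1.2) && if z.2.2 then b else !b)
    ((PolyTime.id.snd.fst.eq PolyTime.id.fst.snd).and
      (PolyTime.id.snd.snd.ite (PolyTime.const b) (PolyTime.const !b)))

theorem polyTime_seen (b : Bool) : PolyTime (seen b) :=
  (polyTime_edges.comp PolyTime.id.fst).any (p := fun z : (Input × ℕ) × (ℕ × List ℕ) =>
      found b (z.1.1, z.2.1) && has (z.2.2, z.1.2))
    (((polyTime_found b).comp (PolyTime.id.fst.fst.pair PolyTime.id.snd.fst)).and
      (polyTime_has.comp (PolyTime.id.snd.snd.pair PolyTime.id.fst.snd)))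

theorem polyTime_aboveCount : PolyTime aboveCount :=
  (polyTime_edges.comp PolyTime.id.fst).countP (p := fun z : (Input × ℕ) × (ℕ × List ℕ) =>
      !probed (z.1.1, z.2.1) && has (z.2.2, z.1.2))
    ((polyTime_probed.comp (PolyTime.id.fst.fst.pair PolyTime.id.snd.fst)).not.and
      (polyTime_has.comp (PolyTime.id.snd.snd.pair PolyTime.id.fst.snd)))

theorem polyTime_need : PolyTime need :=
  PolyTime.id.fst.fst.sub
    (PolyTime.id.snd.countP (p := fun z : Input × (ℕ × Bool) => z.2.2) PolyTime.id.snd.snd)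

theorem polyTime_score : PolyTime score :=
  ((polyTime_seen false).comp (PolyTime.id.fst.pair PolyTime.id.snd.fst)).ite
    (PolyTime.const (0, 1))
    (((polyTime_seen true).comp (PolyTime.id.fst.pair PolyTime.id.snd.fst)).ite
      ((PolyTime.id.fst.fst.fst.add (PolyTime.const 1)).pair (PolyTime.const 1))
      ((PolyTime.id.snd.snd.fst.mul ((polyTime_need.comp PolyTime.id.fst).min
        (polyTime_aboveCount.comp (PolyTime.id.fst.pair PolyTime.id.snd.fst)))).pair
        PolyTime.id.snd.snd.snd))

theorem polyTime_attains : PolyTime attains := by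
  have hs : PolyTime fun z : ((Input × List ℕ) × (ℕ × ℕ)) × (ℕ × (ℕ × ℕ)) =>
      score (z.1.1.1, z.2) := polyTime_score.comp (PolyTime.id.fst.fst.fst.pair PolyTime.id.snd)
  exact (polyTime_latents.comp PolyTime.id.fst.fst).any
    (p := fun z : ((Input × List ℕ) × (ℕ × ℕ)) × (ℕ × (ℕ × ℕ)) => has (z.1.1.2, z.2.1) &&
      decide (z.1.2.1 * (score (z.1.1.1, z.2)).2 ≤ (score (z.1.1.1, z.2)).1 * z.1.2.2))
    ((polyTime_has.comp (PolyTime.id.fst.fst.snd.pair PolyTime.id.snd.fst)).and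
      ((PolyTime.id.fst.snd.fst.mul hs.snd).le (hs.fst.mul PolyTime.id.fst.snd.snd)))

theorem polyTime_beats : PolyTime beats := by
  have hs : PolyTime fun z : ((Input × List ℕ) × List ℕ) × (ℕ × (ℕ × ℕ)) =>
      score (z.1.1.1, z.2) := polyTime_score.comp (PolyTime.id.fst.fst.fst.pair PolyTime.id.snd)
  exact (polyTime_latents.comp PolyTime.id.fst.fst).any
    (p := fun z : ((Input × List ℕ) × List ℕ) × (ℕ × (ℕ × ℕ)) => has (z.1.2, z.2.1) &&
      (!decide ((score (z.1.1.1, z.2)).1 = 0) && !attains (z.1.1, score (z.1.1.1, z.2))))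
    ((polyTime_has.comp (PolyTime.id.fst.snd.pair PolyTime.id.snd.fst)).and
      (hs.fst.eq_zero.not.and (polyTime_attains.comp (PolyTime.id.fst.fst.pair hs)).not))

theorem polyTime_good : PolyTime good :=
  (polyTime_probed.comp (PolyTime.id.fst.pair PolyTime.id.snd.fst)).not.and
    ((polyTime_edges.comp PolyTime.id.fst).any
      (p := fun z : (Input × (ℕ × List ℕ)) × (ℕ × List ℕ) =>
        !probed (z.1.1, z.2.1) && beats ((z.1.1, z.1.2.2), z.2.2))
      ((polyTime_probed.comp (PolyTime.id.fst.fst.pair PolyTime.id.snd.fst)).not.and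
        (polyTime_beats.comp
          ((PolyTime.id.fst.fst.pair PolyTime.id.fst.snd.snd).pair PolyTime.id.snd.snd)))).not

theorem polyTime_choice : PolyTime choice :=
  PolyTime.select 0 polyTime_edges polyTime_good PolyTime.id.fst

end Input

/-! ### Correctness of the algorithm -/

namespace HGP

variable {I : HGP}

/-- The input that presents an instance and a history to the algorithm. -/
def input (I : HGP) (h : I.History) : Input :=
  ((I.k, (List.ofFn fun j => ((I.p j).num.toNat, (I.p j).den), List.ofFn fun i =>
    ((List.finRange I.m).filter (fun j => j ∈ I.N i)).map Fin.val)),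
    h.map fun a => (a.1.val, a.2))

theorem enc_input (h : I.History) : enc (I.input h) = .pair I.code (I.codeHistory h) := by
  simp [enc, input, code, codeHistory, List.map_ofFn, Function.comp_def]

theorem edges_input (h : I.History) : (I.input h).edges = (List.ofFn fun i : Fin I.n => (i.val,
    ((List.finRange I.m).filter (fun j => j ∈ I.N i)).map Fin.val)).reverse := by
  rw [Input.edges, input, enumRev_ofFn]

theorem any_edges (h : I.History) (p : ℕ × List ℕ → Bool) : (I.input h).edges.any p = true ↔
    ∃ i : Fin I.n, p (i.val, ((List.finRange I.m).filter (fun j => j ∈ I.N i)).map Fin.val) := by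
  simp [edges_input, List.any_eq_true, List.mem_ofFn]

theorem any_latents (h : I.History) (p : ℕ × (ℕ × ℕ) → Bool) :
    (I.input h).latents.any p = true ↔
      ∃ j : Fin I.m, p (j.val, ((I.p j).num.toNat, (I.p j).den)) := by
  rw [Input.latents, input, enumRev_ofFn]
  simp [List.any_eq_true, List.mem_ofFn]

theorem has_edge (i : Fin I.n) (j : Fin I.m) :
    Input.has (((List.finRange I.m).filter (fun j => j ∈ I.N i)).map Fin.val, j.val) = true ↔
      j ∈ I.N i := by
  simp [Input.has, List.any_eq_true, Fin.val_inj]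

theorem probed_input (h : I.History) (i : Fin I.n) :
    Input.probed (I.input h, i.val) = true ↔ i ∈ h.map Prod.fst := by
  simp [Input.probed, input, List.any_eq_true, Fin.val_inj]

theorem found_input (b : Bool) (h : I.History) (i : Fin I.n) :
    Input.found b (I.input h, i.val) = true ↔ (i, b) ∈ h := by
  cases b <;> simp [Input.found, input, List.any_eq_true, Fin.val_inj]

theorem seen_false_input (h : I.History) (j : Fin I.m) :
    Input.seen false (I.input h, j.val) = true ↔ j ∈ I.dead h := by
  rw [Input.seen, any_edges, mem_dead]
  simp only [Bool.and_eq_true, found_input, has_edge]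

theorem seen_true_input (h : I.History) (j : Fin I.m) :
    Input.seen true (I.input h, j.val) = true ↔ j ∈ I.touched h := by
  rw [Input.seen, any_edges, mem_touched]
  simp only [Bool.and_eq_true, found_input, has_edge]

theorem aboveCount_input (h : I.History) (j : Fin I.m) :
    Input.aboveCount (I.input h, j.val) = (I.above h j).card := by
  rw [Input.aboveCount, edges_input, List.countP_reverse, List.ofFn_eq_map, List.countP_map,
    List.countP_eq_length_filter, ← List.toFinset_card_of_nodup ((List.nodup_finRange _).filter _)]
  congr 1
  ext i
  simp only [List.mem_toFinset, List.mem_filter, List.mem_finRange, true_and, mem_above,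
    Function.comp, Bool.and_eq_true, has_edge, Bool.not_eq_true', ← Bool.not_eq_true, probed_input]

theorem need_input (h : I.History) : (I.input h).need = I.need h := by
  rw [Input.need, need, input]
  simp [List.countP_map, Function.comp_def]

open Classical in
/-- The score of a latent variable. -/
noncomputable def score (I : HGP) (h : I.History) (j : Fin I.m) : ℚ :=
  if j ∈ I.dead h then 0 else if j ∈ I.touched h then I.k + 1 else I.p j * I.weight h j

theorem score_nonneg (h : I.History) (j : Fin I.m) : 0 ≤ I.score h j := by
  have := I.p_nonneg j
  unfold score; split_ifs <;> positivity

/-- The fraction that stands for the score of `j` in the algorithm. -/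
def scoreFraction (I : HGP) (h : I.History) (j : Fin I.m) : ℕ × ℕ :=
  Input.score (I.input h, (j.val, ((I.p j).num.toNat, (I.p j).den)))

theorem scoreFraction_spec (h : I.History) (j : Fin I.m) : 0 < (I.scoreFraction h j).2 ∧
    I.score h j = ((I.scoreFraction h j).1 : ℚ) / (I.scoreFraction h j).2 := by
  unfold scoreFraction Input.score score
  simp only [seen_false_input, seen_true_input, need_input, aboveCount_input]
  split_ifs
  · simp
  · simp [input]
  · refine ⟨(I.p j).pos, ?_⟩
    have h1 : (((I.p j).num.toNat : ℕ) : ℚ) = (I.p j).num := by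
      exact_mod_cast Int.toNat_of_nonneg (Rat.num_nonneg.2 (I.p_nonneg j))
    rw [Nat.cast_mul, h1, mul_div_right_comm, Rat.num_div_den]
    rfl

theorem good_input (h : I.History) (i : Fin I.n) : Input.good (I.input h, (i.val,
      ((List.finRange I.m).filter (fun j => j ∈ I.N i)).map Fin.val)) = true ↔
    i ∉ h.map Prod.fst ∧ ∀ i' ∉ h.map Prod.fst, ∀ j ∈ I.N i', I.score h j = 0 ∨
      ∃ l ∈ I.N i, I.score h j ≤ I.score h l := by
  have hz : ∀ j, (I.scoreFraction h j).1 = 0 ↔ I.score h j = 0 := fun j => by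
    obtain ⟨h1, h2⟩ := scoreFraction_spec h j
    rw [h2, div_eq_zero_iff]
    simp [h1.ne']
  have hle : ∀ j l, (I.scoreFraction h j).1 * (I.scoreFraction h l).2 ≤
      (I.scoreFraction h l).1 * (I.scoreFraction h j).2 ↔ I.score h j ≤ I.score h l := by
    intro j l
    obtain ⟨h1, h2⟩ := scoreFraction_spec h j
    obtain ⟨h3, h4⟩ := scoreFraction_spec h l
    rw [h2, h4, div_le_div_iff₀ (by exact_mod_cast h1) (by exact_mod_cast h3)]
    exact_mod_cast Iff.rfl
  have hatt : ∀ j, Input.attains ((I.input h,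
      ((List.finRange I.m).filter (fun j => j ∈ I.N i)).map Fin.val), I.scoreFraction h j) = true ↔
      ∃ l ∈ I.N i, I.score h j ≤ I.score h l := by
    intro j
    rw [Input.attains, any_latents]
    simp only [Bool.and_eq_true, has_edge, decide_eq_true_eq]
    exact exists_congr fun l => and_congr_right fun _ => hle j l
  have hbeat : ∀ i' : Fin I.n, Input.beats ((I.input h,
      ((List.finRange I.m).filter (fun j => j ∈ I.N i)).map Fin.val),
      ((List.finRange I.m).filter (fun j => j ∈ I.N i')).map Fin.val) = true ↔
      ∃ j ∈ I.N i', ¬ (I.score h j = 0 ∨ ∃ l ∈ I.N i, I.score h j ≤ I.score h l) := by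
    intro i'
    rw [Input.beats, any_latents]
    simp only [Bool.and_eq_true, has_edge, Bool.not_eq_true', ← Bool.not_eq_true,
      decide_eq_true_eq]
    refine exists_congr fun j => and_congr_right fun _ => ?_
    rw [not_or]
    exact and_congr (not_congr (hz j)) (not_congr (hatt j))
  rw [Input.good]
  simp only [Bool.and_eq_true, Bool.not_eq_true', ← Bool.not_eq_true, probed_input]
  refine and_congr_right fun _ => ?_
  rw [any_edges]
  simp only [Bool.and_eq_true, Bool.not_eq_true', ← Bool.not_eq_true, probed_input, hbeat]
  push Not
  rfl

theorem exists_good {h : I.History} (hl : I.Live h) :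
    ∃ i : Fin I.n, i ∉ h.map Prod.fst ∧ ∀ i' ∉ h.map Prod.fst, ∀ j ∈ I.N i', I.score h j = 0 ∨
      ∃ l ∈ I.N i, I.score h j ≤ I.score h l := by
  have hlen : h.length < I.n := by
    by_contra hn
    exact hl.2 (Or.inr (not_lt.1 hn))
  obtain ⟨i₀, hi₀⟩ : ∃ i : Fin I.n, i ∉ h.map Prod.fst := by
    by_contra hno
    push Not at hno
    have h1 : (Finset.univ : Finset (Fin I.n)) ⊆ (h.map Prod.fst).toFinset :=
      fun i _ => List.mem_toFinset.2 (hno i)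
    have h2 := (Finset.card_le_card h1).trans (List.toFinset_card_le _)
    rw [Finset.card_univ, Fintype.card_fin, List.length_map] at h2
    omega
  rcases (I.fresh h).eq_empty_or_nonempty with he | hne
  · refine ⟨i₀, hi₀, fun i' hi' j hj => Or.inl ?_⟩
    have : j ∈ I.dead h := by
      by_contra hd
      have hf : j ∈ I.fresh h := mem_fresh.2 ⟨⟨i', hi', hj⟩, hd⟩
      rw [he] at hf
      exact absurd hf (Finset.notMem_empty j)
    simp [score, this]
  · obtain ⟨l, hl', hmax⟩ := Finset.exists_max_image (I.fresh h) (I.score h) hne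
    obtain ⟨⟨i, hi, hli⟩, _⟩ := mem_fresh.1 hl'
    refine ⟨i, hi, fun i' hi' j hj => ?_⟩
    by_cases hd : j ∈ I.dead h
    · left; simp [score, hd]
    · exact Or.inr ⟨l, hli, hmax j (mem_fresh.2 ⟨⟨i', hi', hj⟩, hd⟩)⟩

theorem choice_input {h : I.History} (hl : I.Live h) :
    ∃ i : Fin I.n, Input.choice (I.input h) = i.val ∧ i ∉ h.map Prod.fst ∧
      ∀ i' ∉ h.map Prod.fst, ∀ j ∈ I.N i', I.score h j = 0 ∨
        ∃ l ∈ I.N i, I.score h j ≤ I.score h l := by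
  obtain ⟨i, hi⟩ := exists_good hl
  have hmem : ∀ e, e ∈ (I.input h).edges ↔ ∃ i : Fin I.n, (i.val,
      ((List.finRange I.m).filter (fun j => j ∈ I.N i)).map Fin.val) = e := by
    intro e; rw [edges_input, List.mem_reverse, List.mem_ofFn]
  obtain ⟨e, he, hp, hc⟩ := foldl_select (fun e => Input.good (I.input h, e)) Prod.fst
    (I.input h).edges 0 ⟨_, (hmem _).2 ⟨i, rfl⟩, (good_input h i).2 hi⟩
  obtain ⟨i', rfl⟩ := (hmem e).1 he
  exact ⟨i', hc, (good_input h i').1 hp⟩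

/-- The policy of the algorithm.  At histories at which no further probe is due the result of the
algorithm need not be an observed variable; it is reduced modulo `n` to get one. -/
def greedyPolicy (I : HGP) : I.Policy where
  next h := ⟨Input.choice (I.input h) % I.n,
    Nat.mod_lt _ (I.one_le_k.trans I.k_le_n)⟩
  fresh h hl := by
    obtain ⟨i, hi, hm, _⟩ := choice_input hl
    have : (⟨Input.choice (I.input h) % I.n, Nat.mod_lt _ (I.one_le_k.trans I.k_le_n)⟩ :
        Fin I.n) = i := Fin.ext (by simp [hi, Nat.mod_eq_of_lt i.2])
    rwa [this]

theorem greedyPolicy_next {h : I.History} (hl : I.Live h) :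
    Input.choice (I.input h) = (I.greedyPolicy.next h).val ∧
      ∀ i' ∉ h.map Prod.fst, ∀ j ∈ I.N i', I.score h j = 0 ∨
        ∃ l ∈ I.N (I.greedyPolicy.next h), I.score h j ≤ I.score h l := by
  obtain ⟨i, hi, _, hs⟩ := choice_input hl
  have : I.greedyPolicy.next h = i := Fin.ext (by simp [greedyPolicy, hi, Nat.mod_eq_of_lt i.2])
  rw [this]
  exact ⟨hi, hs⟩

theorem isGreedy_greedyPolicy (I : HGP) : I.IsGreedy I.greedyPolicy where
  pursue h hl hcl := by
    obtain ⟨i, hi, j, hj, ht, hd⟩ := hcl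
    have hsj : I.score h j = I.k + 1 := by simp [score, ht, hd]
    rcases (greedyPolicy_next hl).2 i hi j hj with h0 | ⟨l, hl', hle⟩
    · rw [hsj] at h0
      have : (0 : ℚ) ≤ I.k := Nat.cast_nonneg _
      linarith
    · refine ⟨l, hl', ?_⟩
      rw [hsj] at hle
      have hk : (0 : ℚ) ≤ I.k := Nat.cast_nonneg _
      by_contra hno
      have hlt : I.score h l ≤ I.k := by
        unfold score
        split_ifs with h1 h2
        · exact hk
        · exact absurd ⟨h2, h1⟩ hno
        · have hw : (I.weight h l : ℚ) ≤ I.k := by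
            exact_mod_cast (min_le_left _ _).trans (Nat.sub_le _ _)
          have := mul_le_mul (I.p_le_one l) hw (Nat.cast_nonneg _) zero_le_one
          linarith
      linarith
  best h hl hcl i hi j hj hd := by
    have hsc : ∀ i ∉ h.map Prod.fst, ∀ l ∈ I.N i, l ∉ I.dead h →
        I.score h l = I.p l * I.weight h l := by
      intro i hi l hl hd
      have ht : l ∉ I.touched h := fun ht => hcl ⟨i, hi, l, hl, ht, hd⟩
      simp [score, hd, ht]
    rw [← hsc i hi j hj hd]
    by_cases h0 : I.score h j = 0
    · exact Or.inl h0
    · rcases (greedyPolicy_next hl).2 i hi j hj with h1 | ⟨l, hl', hle⟩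
      · exact Or.inl h1
      · have hld : l ∉ I.dead h := by
          intro hld
          have : I.score h l = 0 := by simp [score, hld]
          exact h0 (le_antisymm (this ▸ hle) (score_nonneg h j))
        exact Or.inr ⟨l, hl', hld,
          by rwa [← hsc _ (I.greedyPolicy.fresh h hl) l hl' hld]⟩

/-! ### The running time in terms of the instance -/

/-- A history without repetitions has at most as many entries as there are hyperedges, and every
entry is at most about as long as the number of hyperedges. -/
theorem size_codeHistory_le {h : I.History} (hl : I.Live h) :
    (I.codeHistory h).size ≤ I.code.size * (I.code.size + 5) + 1 := by
  have hlen : h.length ≤ I.n := by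
    by_contra hn
    exact hl.2 (Or.inr (by omega))
  have hn : I.n ≤ I.code.size := by
    have h1 := length_le_esize (List.ofFn fun i : Fin I.n =>
      ((List.finRange I.m).filter (fun j => j ∈ I.N i)).map Fin.val)
    rw [List.length_ofFn] at h1
    have h2 : I.code.size = esize (I.k, (List.ofFn fun j => ((I.p j).num.toNat, (I.p j).den),
        List.ofFn fun i => ((List.finRange I.m).filter (fun j => j ∈ I.N i)).map Fin.val)) := by
      simp [esize, enc, code, List.map_ofFn, Function.comp_def]
    rw [h2, esize_pair, esize_pair]
    omega
  have key : ∀ h : I.History, (I.codeHistory h).size ≤ h.length * (I.n + 5) + 1 := by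
    intro h
    induction h with
    | nil => simp [codeHistory, Val.ofList, Val.size]
    | cons a h ih =>
      have h1 : (I.codeHistory (a :: h)).size =
          Nat.size a.1.val + 1 + esize a.2 + 1 + (I.codeHistory h).size + 1 := rfl
      have h2 : Nat.size a.1.val ≤ a.1.val := Nat.size_le.2 Nat.lt_two_pow_self
      have h3 := a.1.2
      have h4 := esize_bool_le a.2
      rw [h1, List.length_cons, add_mul, one_mul]
      omega
  refine (key h).trans (Nat.succ_le_succ (Nat.mul_le_mul (hlen.trans hn) (by omega)))

end HGP

/-- There are one program, one polynomial and one constant such that, on every instance of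
Hypergraph Probing, the program implements an adaptive policy in polynomial time whose expected
number of probes is within `C * ρ ^ 2 * (1 + log k)` of that of every adaptive policy. -/
theorem theorem4 :
    ∃ (P : Prog) (q : Polynomial ℕ) (C : ℝ), 0 < C ∧
      ∀ I : HGP, 1 ≤ I.rank →
        ∃ π : I.Policy,
          I.Implements P π (q.eval I.code.size) ∧
          ∀ π' : I.Policy,
            I.expCost π ≤ C * (I.rank : ℝ) ^ 2 * (1 + Real.log (I.k : ℝ)) * I.expCost π' := by
  obtain ⟨P, q, hP⟩ := Input.polyTime_choice
  refine ⟨P, q.comp (Polynomial.X + (Polynomial.X * (Polynomial.X + 5) + 1) + 1), 10, by norm_num,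
    fun I hr => ⟨I.greedyPolicy, fun h hl => ?_, fun π' =>
      HGP.expCost_le_of_isGreedy I.isGreedy_greedyPolicy π' hr⟩⟩
  obtain ⟨t, ht, hrun⟩ := hP (I.input h)
  rw [HGP.enc_input, (HGP.greedyPolicy_next hl).1] at hrun
  refine ⟨t, ht.trans ?_, hrun⟩
  rw [Polynomial.eval_comp]
  refine Polynomial.eval_nat_mono q ?_
  have h1 := HGP.size_codeHistory_le hl
  have h2 : esize (I.input h) = I.code.size + (I.codeHistory h).size + 1 := by
    rw [esize, HGP.enc_input, Val.size]
  simp only [Polynomial.eval_add, Polynomial.eval_mul, Polynomial.eval_X, Polynomial.eval_one,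
    Polynomial.eval_ofNat]
  omega
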